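/- All spaces are real and $\mathbb{N}=\{1,2,\dots\}$. Let $X$ and $Y$ be infinite-dimensional Banach spaces and let $\langle\cdot,\cdot\rangle\colon X\times Y\to\mathbb{R}$ be a bilinear map such that (B1) if $x\in X$ and $\langle x,y\rangle=0$ for all $y\in Y$, then $x=0$; (B2) if $y\in Y$ and $\langle x,y\rangle=0$ for all $x\in X$, then $y=0$; (B3) there is a constant $C_d>0$ with $|\langle x,y\rangle|\le C_d\|x\|_X\|y\|_Y$ for all $x\in X$, $y\in Y$. Let $\sigma(X,Y)$ be the topology on $X$ generated by the seminorms $x\mapsto|\langle x,y\rangle|$, $y\in Y$. Unless otherwise stated, series in $X$ are limits of their partial sums in $\sigma(X,Y)$. Let $(e_j)_{j\in\mathbb{N}}\subset X$ and $(f_j)_{j\in\mathbb{N}}\subset Y$ be normalized sequences ($\|e_j\|_X=\|f_j\|_Y=1$) such that (B4) $\langle e_j,f_j\rangle=1$ and $\langle e_j,f_k\rangle=0$ for $j\ne k$; (B5) every $x\in X$ has the unique representation $x=\sum_{j=1}^\infty\langle x,f_j\rangle e_j$. Assume that $(e_j)$ is subsymmetric, i.e. there is a constant $C$ such that - ($C$-unconditional)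 whenever $\sum_j a_je_j$ converges and $(\gamma_j)$ is a bounded sequence of scalars, $\sum_j\gamma_ja_je_j$ converges and $\bigl\|\sum_j\gamma_ja_je_j\bigr\|_X\le C\sup_k|\gamma_k|\,\bigl\|\sum_ja_je_j\bigr\|_X$; - ($C$-spreading) for all scalars $(a_j)$ and all $n_1<n_2<\cdots$, the series $\sum_ja_je_j$ converges if and only if $\sum_ja_je_{n_j}$ does, and in that case $\frac1C\bigl\|\sum_ja_je_{n_j}\bigr\|_X\le\bigl\|\sum_ja_je_j\bigr\|_X\le C\bigl\|\sum_ja_je_{n_j}\bigr\|_X$. For $\Lambda\subset\mathbb{N}$ let $P_\Lambda\colon X\to X$ be the bounded projection $P_\Lambda\bigl(\sum_ja_je_j\bigr)=\sum_{j\in\Lambda}a_je_j$. Assume moreover that $(e_j)$ is non-$\ell^1$-splicing, i.e. for every infinite $\mathcal{I}\subset\mathbb{N}$ and every $\theta>0$ there is a sequence $(\Lambda_j)$ of pairwise disjoint infinite subsets of $\mathcal{I}$ such that for every sequence $(x_j)$ in $X$ with $\|x_j\|_X\le1$ for all $j$ there is a scalar sequence $(a_j)\in\ell^1$ with $\sum_j|a_j|=1$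 and $$\Bigl\|\sum_{j=1}^\infty a_jP_{\Lambda_j}x_j\Bigr\|_X\le\theta$$ (this series converges absolutely in norm). Then for every $1\le p\le\infty$ the Banach space $\ell^p(X)$ of all sequences $(x_n)_{n\in\mathbb{N}}$ in $X$ with $(\|x_n\|_X)_n\in\ell^p$, normed by $\|(\|x_n\|_X)_n\|_{\ell^p}$, is primary: for every bounded linear projection $Q\colon\ell^p(X)\to\ell^p(X)$, at least one of $Q(\ell^p(X))$ and $(I-Q)(\ell^p(X))$ is isomorphic to $\ell^p(X)$ as a Banach space. -/

import Mathlib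

open Filter Topology
open scoped ENNReal

namespace DualPair

noncomputable section

section Pairing

variable {X Y : Type*} [NormedAddCommGroup X] [NormedSpace ℝ X]
  [NormedAddCommGroup Y] [NormedSpace ℝ Y]

/-- The series `∑ a j • u j` converges to `x` in the topology `σ(X, Y)` induced by the pairing `B`
(`WeakBilin B` is `X` with the topology `σ(X, Y)`). -/
def WeakSum (B : X →ₗ[ℝ] Y →ₗ[ℝ] ℝ) (u : ℕ → X) (a : ℕ → ℝ) (x : X) : Prop :=
  Tendsto (fun n : ℕ => (show WeakBilin B from ∑ j ∈ Finset.range n, a j • u j)) atTop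
    (𝓝 (show WeakBilin B from x))

/-- The pairing separates the points of both spaces and is bounded. -/
structure IsDualPair (B : X →ₗ[ℝ] Y →ₗ[ℝ] ℝ) : Prop where
  separatingLeft : ∀ x, (∀ y, B x y = 0) → x = 0
  separatingRight : ∀ y, (∀ x, B x y = 0) → y = 0
  bounded : ∃ C : ℝ, 0 < C ∧ ∀ x y, |B x y| ≤ C * ‖x‖ * ‖y‖

/-- `(e j)` and `(f j)` are normalized and biorthogonal, and each `x` has the unique representation
`x = ∑ B x (f j) • e j`, the series being `σ(X, Y)`-convergent. -/
structure IsBiorthogonalBasis (B : X →ₗ[ℝ] Y →ₗ[ℝ] ℝ) (e : ℕ → X) (f : ℕ → Y) : Prop where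
  norm_left : ∀ j, ‖e j‖ = 1
  norm_right : ∀ j, ‖f j‖ = 1
  pair_self : ∀ j, B (e j) (f j) = 1
  pair_ne : ∀ j k, j ≠ k → B (e j) (f k) = 0
  expansion : ∀ x, WeakSum B e (fun j => B x (f j)) x
  unique : ∀ x a, WeakSum B e a x → a = fun j => B x (f j)

/-- `C`-unconditionality: if `∑ a j • e j` converges to `x` and `γ` is bounded, then
`∑ γ j • a j • e j` converges, to a vector of norm at most `C * sup |γ k| * ‖x‖`
(all series in `σ(X, Y)`). -/
def IsUnconditionalWith (B : X →ₗ[ℝ] Y →ₗ[ℝ] ℝ) (e : ℕ → X) (C : ℝ) : Prop :=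
  ∀ (a γ : ℕ → ℝ) (x : X), BddAbove (Set.range fun k => |γ k|) → WeakSum B e a x →
    ∃ z, WeakSum B e (fun j => γ j * a j) z ∧ ‖z‖ ≤ C * (⨆ k, |γ k|) * ‖x‖

/-- `C`-spreading: `(e j)` is `C`-equivalent to each of its increasing subsequences
(all series in `σ(X, Y)`). -/
def IsSpreadingWith (B : X →ₗ[ℝ] Y →ₗ[ℝ] ℝ) (e : ℕ → X) (C : ℝ) : Prop :=
  ∀ (a : ℕ → ℝ) (n : ℕ → ℕ), StrictMono n →
    ((∃ x, WeakSum B e a x) ↔ ∃ z, WeakSum B (fun j => e (n j)) a z) ∧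
    ∀ x z, WeakSum B e a x → WeakSum B (fun j => e (n j)) a z →
      1 / C * ‖z‖ ≤ ‖x‖ ∧ ‖x‖ ≤ C * ‖z‖

/-- `(C_u, C_s)`-subsymmetry. -/
def IsSubsymmetricWith (B : X →ₗ[ℝ] Y →ₗ[ℝ] ℝ) (e : ℕ → X) (Cu Cs : ℝ) : Prop :=
  IsUnconditionalWith B e Cu ∧ IsSpreadingWith B e Cs

/-- Subsymmetry: `(C, C)`-subsymmetry for some constant `C`. -/
def IsSubsymmetric (B : X →ₗ[ℝ] Y →ₗ[ℝ] ℝ) (e : ℕ → X) : Prop :=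
  ∃ C : ℝ, IsSubsymmetricWith B e C C

open Classical in
/-- The coordinate projection `P_Λ (∑ a j • e j) = ∑_{j ∈ Λ} a j • e j`. For an unconditional
basis the series always converges and the limit is unique, see `weakSum_coordProj`,
`eq_coordProj`, `norm_coordProj_le`. -/
def coordProj (B : X →ₗ[ℝ] Y →ₗ[ℝ] ℝ) (e : ℕ → X) (f : ℕ → Y) (Λ : Set ℕ) (x : X) : X :=
  if h : ∃ z, WeakSum B e (Λ.indicator fun j => B x (f j)) z then h.choose else 0

/-- Non-`ℓ¹`-splicing sequences (stated for unconditional bases). The series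
`∑ a j • P_{Λ j} (x j)` is then absolutely convergent in norm. -/
def IsNonL1Splicing (B : X →ₗ[ℝ] Y →ₗ[ℝ] ℝ) (e : ℕ → X) (f : ℕ → Y) : Prop :=
  ∀ I : Set ℕ, I.Infinite → ∀ θ : ℝ, 0 < θ →
    ∃ Λ : ℕ → Set ℕ, (∀ j, (Λ j).Infinite) ∧ (∀ j, Λ j ⊆ I) ∧
      (∀ j k, j ≠ k → Disjoint (Λ j) (Λ k)) ∧
      ∀ x : ℕ → X, (∀ j, ‖x j‖ ≤ 1) →
        ∃ (a : ℕ → ℝ) (z : X), HasSum (fun j => |a j|) 1 ∧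
          HasSum (fun j => a j • coordProj B e f (Λ j) (x j)) z ∧ ‖z‖ ≤ θ

theorem weakSum_iff {B : X →ₗ[ℝ] Y →ₗ[ℝ] ℝ} (hB : IsDualPair B) {u : ℕ → X} {a : ℕ → ℝ} {x : X} :
    WeakSum B u a x ↔
      ∀ y, Tendsto (fun n : ℕ => ∑ j ∈ Finset.range n, a j * B (u j) y) atTop (𝓝 (B x y)) := by
  have inj : Function.Injective B := by
    refine (injective_iff_map_eq_zero B).2 fun x hx => hB.separatingLeft x fun y => ?_
    rw [hx, LinearMap.zero_apply]
  refine (WeakBilin.tendsto_iff_forall_eval_tendsto B inj).trans (forall_congr' fun y => ?_)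
  have h : ∀ n : ℕ, B (∑ j ∈ Finset.range n, a j • u j) y
      = ∑ j ∈ Finset.range n, a j * B (u j) y := by
    intro n
    simp [LinearMap.sum_apply]
  simp only [← h]
  rfl

theorem WeakSum.eq {B : X →ₗ[ℝ] Y →ₗ[ℝ] ℝ} (hB : IsDualPair B) {u : ℕ → X} {a : ℕ → ℝ} {x z : X}
    (hx : WeakSum B u a x) (hz : WeakSum B u a z) : x = z := by
  refine sub_eq_zero.1 (hB.separatingLeft _ fun y => ?_)
  rw [map_sub, LinearMap.sub_apply, sub_eq_zero]
  exact tendsto_nhds_unique ((weakSum_iff hB).1 hx y) ((weakSum_iff hB).1 hz y)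

theorem exists_coordProj {B : X →ₗ[ℝ] Y →ₗ[ℝ] ℝ} {e : ℕ → X} {f : ℕ → Y} {C : ℝ}
    (hb : IsBiorthogonalBasis B e f) (hu : IsUnconditionalWith B e C) (Λ : Set ℕ) (x : X) :
    ∃ z, WeakSum B e (Λ.indicator fun j => B x (f j)) z ∧ ‖z‖ ≤ |C| * ‖x‖ := by
  have hle : ∀ k, |Λ.indicator (fun _ => (1 : ℝ)) k| ≤ 1 := by
    intro k
    by_cases hk : k ∈ Λ <;> simp [hk]
  obtain ⟨z, hz, hn⟩ := hu (fun j => B x (f j)) (Λ.indicator fun _ => 1) x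
    ⟨1, by rintro _ ⟨k, rfl⟩; exact hle k⟩ (hb.expansion x)
  have heq : (fun j => Λ.indicator (fun _ => (1 : ℝ)) j * B x (f j))
      = Λ.indicator fun j => B x (f j) := by
    funext j
    by_cases hj : j ∈ Λ <;> simp [hj]
  rw [heq] at hz
  refine ⟨z, hz, hn.trans ?_⟩
  have h0 : 0 ≤ ⨆ k, |Λ.indicator (fun _ => (1 : ℝ)) k| := Real.iSup_nonneg fun _ => abs_nonneg _
  have h1 : ⨆ k, |Λ.indicator (fun _ => (1 : ℝ)) k| ≤ 1 := ciSup_le hle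
  refine mul_le_mul_of_nonneg_right ?_ (norm_nonneg x)
  calc C * (⨆ k, |Λ.indicator (fun _ => (1 : ℝ)) k|)
      ≤ |C| * (⨆ k, |Λ.indicator (fun _ => (1 : ℝ)) k|) :=
        mul_le_mul_of_nonneg_right (le_abs_self C) h0
    _ ≤ |C| * 1 := mul_le_mul_of_nonneg_left h1 (abs_nonneg C)
    _ = |C| := mul_one _

theorem weakSum_coordProj {B : X →ₗ[ℝ] Y →ₗ[ℝ] ℝ} {e : ℕ → X} {f : ℕ → Y} {C : ℝ}
    (hb : IsBiorthogonalBasis B e f) (hu : IsUnconditionalWith B e C) (Λ : Set ℕ) (x : X) :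
    WeakSum B e (Λ.indicator fun j => B x (f j)) (coordProj B e f Λ x) := by
  have h : ∃ z, WeakSum B e (Λ.indicator fun j => B x (f j)) z :=
    (exists_coordProj hb hu Λ x).imp fun _ hz => hz.1
  rw [coordProj, dif_pos h]
  exact h.choose_spec

theorem eq_coordProj {B : X →ₗ[ℝ] Y →ₗ[ℝ] ℝ} {e : ℕ → X} {f : ℕ → Y} {C : ℝ} (hB : IsDualPair B)
    (hb : IsBiorthogonalBasis B e f) (hu : IsUnconditionalWith B e C) {Λ : Set ℕ} {x z : X}
    (hz : WeakSum B e (Λ.indicator fun j => B x (f j)) z) : z = coordProj B e f Λ x :=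
  hz.eq hB (weakSum_coordProj hb hu Λ x)

theorem norm_coordProj_le {B : X →ₗ[ℝ] Y →ₗ[ℝ] ℝ} {e : ℕ → X} {f : ℕ → Y} {C : ℝ}
    (hB : IsDualPair B) (hb : IsBiorthogonalBasis B e f) (hu : IsUnconditionalWith B e C)
    (Λ : Set ℕ) (x : X) : ‖coordProj B e f Λ x‖ ≤ |C| * ‖x‖ := by
  obtain ⟨z, hz, hn⟩ := exists_coordProj hb hu Λ x
  rwa [eq_coordProj hB hb hu hz] at hn

end Pairing

/-- `E` is primary: for every bounded projection `Q` on `E`, the range of `Q` or the range of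
`1 - Q` is isomorphic to `E` (isomorphisms are linear homeomorphisms). -/
def IsPrimarySpace (E : Type*) [NormedAddCommGroup E] [NormedSpace ℝ E] : Prop :=
  ∀ Q : E →L[ℝ] E, IsIdempotentElem Q →
    Nonempty (Q.range ≃L[ℝ] E) ∨ Nonempty ((1 - Q).range ≃L[ℝ] E)

end

end DualPair

/-! Let E = ℓ^p(X). By Pełczyński's decomposition method (`nonempty_range_equiv_of_factor`) it
suffices that for every operator T on E the identity factors through T or through 1 - T
(`exists_factor`). The range of one of the two projections then contains a complemented copy of E,
and E ≅ ℓ^p(E) absorbs that range.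

To factor the identity, T is compressed to a copy of E on which it is almost diagonal.
Unconditionality and spreading make any choice of rows `r i` and increasing positions `ν i k` span a
complemented copy of E, via `pushL` and `pullL`. If the off-diagonal part of T at these positions is
small, the compression is close to a diagonal operator with entries d i k (`exists_near_diagonal`).
As |d| + |1 - d| ≥ 1, for d or for 1 - d infinitely many rows have infinitely many entries of
modulus at least 1/2. On those positions the diagonal operator is invertible, and a Neumann series
absorbs the error.

The unit vectors need not span a norm-dense subspace, so entrywise smallness is not enough. Two
estimates on whole coordinate subspaces replace it. First, non-ℓ¹-splicing makes every functional on
X small on some P_Λ X with Λ infinite inside a prescribed infinite set (`exists_small`); this lifts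
to E in `exists_refines_functional` and shows that the e_j are weakly null. Second, if the
coordinates of x tend to a along an infinite set, some infinite subset Λ has ‖P_Λ x‖ ≤ η + L|a|
(`exists_proj_le`, lifted in `exists_refines_vector`). For the images T v of unit vectors v, these
limits are values at v of fixed functionals, hence small for late v in a row. `exists_step` combines
both, and `exists_positions` iterates it. -/

namespace DualPair

noncomputable section

/-! ### Coordinate systems in X and their multiplier, spreading and compression operators. -/

/-- A weighted composition that is bounded vector by vector is a bounded operator. -/
lemma exists_clm_of_coords {X : Type*} [NormedAddCommGroup X] [NormedSpace ℝ X]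
    (c : ℕ → X →L[ℝ] ℝ) (ext : ∀ x y, (∀ j, c j x = c j y) → x = y) (γ : ℕ → ℝ) (g : ℕ → ℕ)
    (K : ℝ) (h : ∀ x, ∃ z, (∀ j, c j z = γ j * c (g j) x) ∧ ‖z‖ ≤ K * ‖x‖) :
    ∃ A : X →L[ℝ] X, (∀ x j, c j (A x) = γ j * c (g j) x) ∧ ∀ x, ‖A x‖ ≤ K * ‖x‖ := by
  choose A h1 h2 using h
  refine ⟨LinearMap.mkContinuous
    { toFun := A
      map_add' := fun x y => ext _ _ fun j => by
        rw [map_add, h1, h1, h1, map_add, mul_add]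
      map_smul' := fun a x => ext _ _ fun j => by
        rw [RingHom.id_apply, map_smul, h1, h1, map_smul, smul_eq_mul, smul_eq_mul,
          mul_left_comm] } K h2, h1, h2⟩

/-- A subsymmetric non-`ℓ¹`-splicing system `e` in `X`, described through its coordinate
functionals `c j`, which determine the vectors of `X`. -/
structure CoordSystem (X : Type*) [NormedAddCommGroup X] [NormedSpace ℝ X] where
  e : ℕ → X
  c : ℕ → X →L[ℝ] ℝ
  C : ℝ
  one_le : 1 ≤ C
  norm_e : ∀ j, ‖e j‖ = 1
  norm_c : ∀ j x, |c j x| ≤ C * ‖x‖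
  c_e : ∀ j k, c j (e k) = if j = k then 1 else 0
  ext : ∀ x y, (∀ j, c j x = c j y) → x = y
  mul : ∀ (γ : ℕ → ℝ) (M : ℝ), (∀ k, |γ k| ≤ M) → ∀ x, ∃ z,
    (∀ j, c j z = γ j * c j x) ∧ ‖z‖ ≤ C * M * ‖x‖
  -- The indicator cancels the arbitrary values of `Function.invFun` off the range of `n`.
  spread : ∀ n : ℕ → ℕ, StrictMono n → ∀ x, ∃ z,
    (∀ j, c j z = (Set.range n).indicator 1 j * c (Function.invFun n j) x) ∧ ‖z‖ ≤ C * ‖x‖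
  compress : ∀ n : ℕ → ℕ, StrictMono n → ∀ x, ∃ z,
    (∀ j, c j z = 1 * c (n j) x) ∧ ‖z‖ ≤ C * ‖x‖
  small : ∀ (φ : X →L[ℝ] ℝ) (I : Set ℕ), I.Infinite → ∀ η : ℝ, 0 < η → ∃ Λ ⊆ I, Λ.Infinite ∧
    ∀ x z, (∀ j, c j z = Λ.indicator 1 j * c j x) → |φ z| ≤ η * ‖x‖

namespace CoordSystem

variable {X : Type*} [NormedAddCommGroup X] [NormedSpace ℝ X] (S : CoordSystem X)

lemma C_pos : 0 < S.C := zero_lt_one.trans_le S.one_le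

/-- The operator sending `x` to the vector with coordinates `γ j * c (g j) x`. -/
def weightedComp (γ : ℕ → ℝ) (g : ℕ → ℕ) (K : ℝ)
    (h : ∀ x, ∃ z, (∀ j, S.c j z = γ j * S.c (g j) x) ∧ ‖z‖ ≤ K * ‖x‖) : X →L[ℝ] X :=
  (exists_clm_of_coords S.c S.ext γ g K h).choose

lemma c_weightedComp (γ : ℕ → ℝ) (g : ℕ → ℕ) (K : ℝ) (h) (x : X) (j : ℕ) :
    S.c j (S.weightedComp γ g K h x) = γ j * S.c (g j) x :=
  (exists_clm_of_coords S.c S.ext γ g K h).choose_spec.1 x j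

lemma weightedComp_le (γ : ℕ → ℝ) (g : ℕ → ℕ) (K : ℝ) (h) (x : X) :
    ‖S.weightedComp γ g K h x‖ ≤ K * ‖x‖ :=
  (exists_clm_of_coords S.c S.ext γ g K h).choose_spec.2 x

lemma abs_indicator_le (Λ : Set ℕ) (k : ℕ) : |Λ.indicator (1 : ℕ → ℝ) k| ≤ 1 := by
  by_cases hk : k ∈ Λ <;> simp [hk]

/-- The multiplier operator with bounded symbol `γ`. -/
def diag (γ : ℕ → ℝ) (M : ℝ) (h : ∀ k, |γ k| ≤ M) : X →L[ℝ] X :=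
  S.weightedComp γ id (S.C * M) (S.mul γ M h)

/-- The coordinate projection onto `Λ`. -/
def proj (Λ : Set ℕ) : X →L[ℝ] X := S.diag (Λ.indicator 1) 1 (abs_indicator_le Λ)

/-- The operator placing the `j`-th coordinate at position `n j`. -/
def spreadMap (n : ℕ → ℕ) (hn : StrictMono n) : X →L[ℝ] X :=
  S.weightedComp ((Set.range n).indicator 1) (Function.invFun n) S.C (S.spread n hn)

/-- The operator reading the coordinates at the positions `n j`. -/
def compressMap (n : ℕ → ℕ) (hn : StrictMono n) : X →L[ℝ] X :=
  S.weightedComp (fun _ => 1) n S.C (S.compress n hn)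

lemma c_diag (γ : ℕ → ℝ) (M : ℝ) (h) (x : X) (j : ℕ) :
    S.c j (S.diag γ M h x) = γ j * S.c j x := S.c_weightedComp _ _ _ _ _ _

lemma diag_le (γ : ℕ → ℝ) (M : ℝ) (h) (x : X) : ‖S.diag γ M h x‖ ≤ S.C * M * ‖x‖ :=
  S.weightedComp_le _ _ _ _ _

lemma c_proj (Λ : Set ℕ) (x : X) (j : ℕ) :
    S.c j (S.proj Λ x) = Λ.indicator 1 j * S.c j x := S.c_diag _ _ _ _ _

lemma proj_le (Λ : Set ℕ) (x : X) : ‖S.proj Λ x‖ ≤ S.C * ‖x‖ := by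
  have := S.diag_le (Λ.indicator 1) 1 (abs_indicator_le Λ) x
  rwa [mul_one] at this

lemma c_spreadMap (n : ℕ → ℕ) (hn : StrictMono n) (x : X) (j : ℕ) :
    S.c (n j) (S.spreadMap n hn x) = S.c j x := by
  have := S.c_weightedComp ((Set.range n).indicator 1) (Function.invFun n) S.C (S.spread n hn) x (n j)
  rw [Function.leftInverse_invFun hn.injective j] at this
  simpa [spreadMap] using this

lemma c_spreadMap_of_notMem (n : ℕ → ℕ) (hn : StrictMono n) (x : X) {j : ℕ}
    (hj : j ∉ Set.range n) : S.c j (S.spreadMap n hn x) = 0 := by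
  rw [spreadMap, c_weightedComp, Set.indicator_of_notMem hj, zero_mul]

lemma spreadMap_le (n : ℕ → ℕ) (hn : StrictMono n) (x : X) :
    ‖S.spreadMap n hn x‖ ≤ S.C * ‖x‖ := S.weightedComp_le _ _ _ _ _

lemma c_compressMap (n : ℕ → ℕ) (hn : StrictMono n) (x : X) (j : ℕ) :
    S.c j (S.compressMap n hn x) = S.c (n j) x := by
  rw [compressMap, c_weightedComp, one_mul]

lemma compressMap_le (n : ℕ → ℕ) (hn : StrictMono n) (x : X) :
    ‖S.compressMap n hn x‖ ≤ S.C * ‖x‖ := S.weightedComp_le _ _ _ _ _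

lemma exists_abs_proj_le (φ : X →L[ℝ] ℝ) {I : Set ℕ} (hI : I.Infinite) {η : ℝ} (hη : 0 < η) :
    ∃ Λ ⊆ I, Λ.Infinite ∧ ∀ x, |φ (S.proj Λ x)| ≤ η * ‖x‖ := by
  obtain ⟨Λ, h1, h2, h3⟩ := S.small φ I hI η hη
  exact ⟨Λ, h1, h2, fun x => h3 x _ (S.c_proj Λ x)⟩

lemma proj_e {Λ : Set ℕ} {k : ℕ} (hk : k ∈ Λ) : S.proj Λ (S.e k) = S.e k := by
  refine S.ext _ _ fun j => ?_
  rw [c_proj, c_e]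
  rcases eq_or_ne j k with rfl | h
  · simp [hk]
  · simp [h]

/-- The system `(e j)` is weakly null. -/
lemma tendsto_apply_e (φ : X →L[ℝ] ℝ) : Tendsto (fun k => φ (S.e k)) atTop (𝓝 0) := by
  rw [Metric.tendsto_nhds]
  intro ε hε
  by_contra h
  have hI : {k | ε ≤ |φ (S.e k)|}.Infinite := by
    rw [← Nat.frequently_atTop_iff_infinite]
    simpa [Filter.Frequently] using h
  obtain ⟨Λ, h1, h2, h3⟩ := S.exists_abs_proj_le φ hI (half_pos hε)
  obtain ⟨k, hk⟩ := h2.nonempty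
  have := h3 (S.e k)
  rw [S.proj_e hk, S.norm_e] at this
  have h4 : ε ≤ |φ (S.e k)| := h1 hk
  linarith

lemma proj_proj_of_subset {Λ Λ' : Set ℕ} (h : Λ' ⊆ Λ) (x : X) :
    S.proj Λ' (S.proj Λ x) = S.proj Λ' x := by
  refine S.ext _ _ fun j => ?_
  rw [c_proj, c_proj, c_proj]
  by_cases hj : j ∈ Λ'
  · simp [hj, h hj]
  · simp [hj]

lemma exists_strictMono_of_tendsto {g : ℕ → ℝ} {I : Set ℕ} (hI : I.Infinite) {a : ℝ}
    (hg : Tendsto g (atTop ⊓ 𝓟 I) (𝓝 a)) {ε : ℕ → ℝ} (hε : ∀ n, 0 < ε n) :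
    ∃ n : ℕ → ℕ, StrictMono n ∧ (∀ i, n i ∈ I) ∧ ∀ i, |g (n i) - a| ≤ ε i := by
  have key : ∀ i, ∃ᶠ k in atTop, k ∈ I ∧ |g k - a| ≤ ε i := by
    intro i
    have h1 : ∀ᶠ k in atTop, k ∈ I → |g k - a| ≤ ε i := by
      have := (Metric.tendsto_nhds.1 hg) (ε i) (hε i)
      rw [eventually_inf_principal] at this
      filter_upwards [this] with k hk hkI
      exact (hk hkI).le
    have h2 : ∃ᶠ k in atTop, k ∈ I := Nat.frequently_atTop_iff_infinite.2 hI
    exact (h2.and_eventually h1).mono fun k hk => ⟨hk.1, hk.2 hk.1⟩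
  obtain ⟨n, hn, h⟩ := extraction_forall_of_frequently key
  exact ⟨n, hn, fun i => (h i).1, fun i => (h i).2⟩

/-- If the coordinates of some vector do not tend to zero along an infinite set, then the system
is equivalent to the unit vectors of `ℓ^∞`. -/
lemma exists_ones {x : X} {I : Set ℕ} (hI : I.Infinite) {a : ℝ}
    (hx : Tendsto (fun k => S.c k x) (atTop ⊓ 𝓟 I) (𝓝 a)) (ha : a ≠ 0) :
    ∃ u, ∀ j, S.c j u = 1 := by
  have ha' : 0 < |a| / 2 := by positivity
  obtain ⟨n, hn, h1, h2⟩ := exists_strictMono_of_tendsto hI hx (ε := fun _ => |a| / 2) fun _ => ha'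
  have h3 : ∀ i, |a| / 2 ≤ |S.c (n i) x| := fun i => by
    have := abs_sub_abs_le_abs_sub a (S.c (n i) x)
    rw [abs_sub_comm] at this
    linarith [h2 i]
  -- Along `n` the coordinates are bounded away from zero, so their reciprocals form a bounded
  -- multiplier.
  obtain ⟨z, hz, -⟩ := S.mul (fun i => (S.c i (S.compressMap n hn x))⁻¹) (|a| / 2)⁻¹ (fun k => by
    rw [c_compressMap, abs_inv]
    exact inv_anti₀ ha' (h3 k)) (S.compressMap n hn x)
  refine ⟨z, fun j => ?_⟩
  rw [hz, c_compressMap, inv_mul_cancel₀]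
  intro h0
  have := h3 j
  rw [h0, abs_zero] at this
  linarith

variable [CompleteSpace X]

/-- Selecting coordinates summably close to `a` splits the projection of `x` into a norm-convergent
series and `a` times a projection of the all-ones vector. That vector is needed only for `a ≠ 0`,
and then `exists_ones` supplies it. -/
lemma exists_proj_le : ∃ L : ℝ, 0 ≤ L ∧ ∀ (x : X) (I : Set ℕ) (a : ℝ), I.Infinite →
    Tendsto (fun k => S.c k x) (atTop ⊓ 𝓟 I) (𝓝 a) → ∀ η : ℝ, 0 < η →
    ∃ Λ ⊆ I, Λ.Infinite ∧ ‖S.proj Λ x‖ ≤ η + L * |a| := by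
  -- Fixing `u` in advance, with default 0 if there is no all-ones vector, makes `L` independent of
  -- `x` and `I`.
  obtain ⟨u, hu⟩ : ∃ u : X, (∃ z, ∀ j, S.c j z = 1) → ∀ j, S.c j u = 1 := by
    by_cases h : ∃ z, ∀ j, S.c j z = 1
    · obtain ⟨z, hz⟩ := h
      exact ⟨z, fun _ => hz⟩
    · exact ⟨0, fun h' => absurd h' h⟩
  refine ⟨S.C * ‖u‖, by have := S.C_pos; positivity, fun x I a hI hx η hη => ?_⟩
  have hau : ∀ j, a * S.c j u = a := by
    intro j
    rcases eq_or_ne a 0 with rfl | ha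
    · simp
    · rw [hu (S.exists_ones hI hx ha), mul_one]
  obtain ⟨n, hn, h1, h2⟩ := exists_strictMono_of_tendsto hI hx (ε := fun i => η / 2 / 2 ^ i)
    fun i => by positivity
  have hsum : HasSum (fun i : ℕ => η / 2 / 2 ^ i) η := hasSum_geometric_two' η
  have hle : ∀ i, ‖(S.c (n i) x - a) • S.e (n i)‖ ≤ η / 2 / 2 ^ i := fun i => by
    rw [norm_smul, S.norm_e, mul_one]
    exact h2 i
  have hs : Summable fun i => (S.c (n i) x - a) • S.e (n i) :=
    Summable.of_norm_bounded hsum.summable hle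
  have heq : S.proj (Set.range n) x
      = ∑' i, (S.c (n i) x - a) • S.e (n i) + a • S.proj (Set.range n) u := by
    refine S.ext _ _ fun j => ?_
    rw [map_add, (S.c j).map_tsum hs, map_smul, c_proj, c_proj]
    simp only [map_smul, c_e, smul_eq_mul]
    by_cases hj : j ∈ Set.range n
    · obtain ⟨i, rfl⟩ := hj
      rw [tsum_eq_single i fun k hk => by simp [hn.injective.ne hk.symm]]
      simp [hau]
    · have : ∀ i, j ≠ n i := fun i h => hj ⟨i, h.symm⟩
      simp [hj, this]
  refine ⟨Set.range n, Set.range_subset_iff.2 h1, Set.infinite_range_of_injective hn.injective, ?_⟩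
  rw [heq]
  refine (norm_add_le _ _).trans (add_le_add (tsum_of_norm_bounded hsum hle) ?_)
  rw [norm_smul, Real.norm_eq_abs, mul_comm]
  exact mul_le_mul_of_nonneg_right (S.proj_le _ _) (abs_nonneg _)

end CoordSystem

/-! ### Row-wise operators between ℓ^p spaces. -/

section Lp

variable {G H : Type*} [NormedAddCommGroup G] [NormedSpace ℝ G] [NormedAddCommGroup H]
  [NormedSpace ℝ H] {p : ℝ≥0∞} [hp : Fact (1 ≤ p)]

-- Injectivity of `g` on `s` means that each entry of `x` is used at most once, so the estimate
-- survives passing to ℓ^p norms.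
omit [NormedSpace ℝ G] [NormedSpace ℝ H] in
lemma memℓp_and_norm_le_of_injOn (x : lp (fun _ : ℕ => G) p) (y : ℕ → H) {s : Set ℕ} {g : ℕ → ℕ}
    (hg : Set.InjOn g s) {K : ℝ} (hK : 0 ≤ K) (h0 : ∀ i ∉ s, y i = 0)
    (hs : ∀ i ∈ s, ‖y i‖ ≤ K * ‖x (g i)‖) :
    ∃ h : Memℓp y p, ‖(⟨y, h⟩ : lp (fun _ : ℕ => H) p)‖ ≤ K * ‖x‖ := by
  have hp0 : p ≠ 0 := (zero_lt_one.trans_le hp.out).ne'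
  have hx := lp.norm_apply_le_norm hp0 x
  have hxn := norm_nonneg x
  rcases eq_or_ne p ∞ with rfl | hpt
  · have hb : ∀ i, ‖y i‖ ≤ K * ‖x‖ := fun i => by
      by_cases hi : i ∈ s
      · exact (hs i hi).trans (mul_le_mul_of_nonneg_left (hx _) hK)
      · rw [h0 i hi, norm_zero]; positivity
    refine ⟨memℓp_infty ⟨K * ‖x‖, ?_⟩, ?_⟩
    · rintro _ ⟨i, rfl⟩; exact hb i
    · exact lp.norm_le_of_forall_le (by positivity) hb
  · have hpp : 0 < p.toReal := ENNReal.toReal_pos hp0 hpt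
    have hb : ∀ t : Finset ℕ, ∑ i ∈ t, ‖y i‖ ^ p.toReal ≤ (K * ‖x‖) ^ p.toReal := fun t => by
      classical
      calc ∑ i ∈ t, ‖y i‖ ^ p.toReal = ∑ i ∈ t with i ∈ s, ‖y i‖ ^ p.toReal := by
            refine (Finset.sum_filter_of_ne fun i _ hne => ?_).symm
            by_contra hi
            exact hne (by rw [h0 i hi, norm_zero, Real.zero_rpow hpp.ne'])
        _ ≤ ∑ i ∈ t with i ∈ s, K ^ p.toReal * ‖x (g i)‖ ^ p.toReal := by
            refine Finset.sum_le_sum fun i hi => ?_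
            rw [← Real.mul_rpow hK (norm_nonneg _)]
            exact Real.rpow_le_rpow (norm_nonneg _) (hs i (Finset.mem_filter.1 hi).2) hpp.le
        _ = K ^ p.toReal * ∑ j ∈ (t.filter (· ∈ s)).image g, ‖x j‖ ^ p.toReal := by
            rw [Finset.sum_image fun a ha b hb hab => hg (Finset.mem_filter.1 ha).2
              (Finset.mem_filter.1 hb).2 hab, Finset.mul_sum]
        _ ≤ K ^ p.toReal * ‖x‖ ^ p.toReal :=
            mul_le_mul_of_nonneg_left (lp.sum_rpow_le_norm_rpow hpp x _) (by positivity)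
        _ = (K * ‖x‖) ^ p.toReal := (Real.mul_rpow hK hxn).symm
    exact ⟨memℓp_gen' hb, lp.norm_le_of_forall_sum_le hpp (by positivity) hb⟩

open Classical in
/-- The operator sending `x` to the sequence with entries `V i (x (g i))` for `i ∈ s`, and `0`
otherwise. -/
def lpOp (p : ℝ≥0∞) [Fact (1 ≤ p)] (s : Set ℕ) (g : ℕ → ℕ) (hg : Set.InjOn g s)
    (V : ℕ → G →L[ℝ] H) (K : ℝ) (hK : 0 ≤ K) (hV : ∀ i x, ‖V i x‖ ≤ K * ‖x‖) :
    lp (fun _ : ℕ => G) p →L[ℝ] lp (fun _ : ℕ => H) p :=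
  have key : ∀ x : lp (fun _ : ℕ => G) p,
      ∃ h : Memℓp (fun i => if i ∈ s then V i (x (g i)) else 0) p,
        ‖(⟨_, h⟩ : lp (fun _ : ℕ => H) p)‖ ≤ K * ‖x‖ := fun x =>
    memℓp_and_norm_le_of_injOn x _ hg hK (fun i hi => if_neg hi)
      fun i hi => by rw [if_pos hi]; exact hV _ _
  LinearMap.mkContinuous
    { toFun := fun x => ⟨_, (key x).1⟩
      map_add' := fun x y => lp.ext (by
        funext i
        simp only [lp.coeFn_add, Pi.add_apply, map_add]
        split_ifs <;> simp)
      map_smul' := fun a x => lp.ext (by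
        funext i
        simp only [lp.coeFn_smul, Pi.smul_apply, map_smul, RingHom.id_apply]
        split_ifs <;> simp) } K
    fun x => (key x).2

variable (s : Set ℕ) (g : ℕ → ℕ) (hg : Set.InjOn g s)
    (V : ℕ → G →L[ℝ] H) (K : ℝ) (hK : 0 ≤ K) (hV : ∀ i x, ‖V i x‖ ≤ K * ‖x‖)

lemma lpOp_apply_of_mem (x : lp (fun _ : ℕ => G) p) {i : ℕ} (hi : i ∈ s) :
    lpOp p s g hg V K hK hV x i = V i (x (g i)) := if_pos hi

lemma lpOp_apply_of_notMem (x : lp (fun _ : ℕ => G) p) {i : ℕ} (hi : i ∉ s) :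
    lpOp p s g hg V K hK hV x i = 0 := if_neg hi

open Classical in
lemma lpOp_le (x : lp (fun _ : ℕ => G) p) : ‖lpOp p s g hg V K hK hV x‖ ≤ K * ‖x‖ :=
  (memℓp_and_norm_le_of_injOn x _ hg hK (fun i hi => if_neg hi)
      fun i hi => by rw [if_pos hi]; exact hV _ _).2

end Lp

/-- A sequential form of the Banach-Alaoglu theorem for countably many evaluations. -/
lemma exists_tendsto_subseq_functional {E : Type*} [NormedAddCommGroup E] [NormedSpace ℝ E]
    (Φ : ℕ → E →L[ℝ] ℝ) {K : ℝ} (hΦ : ∀ n, ‖Φ n‖ ≤ K) (v : ℕ → E) :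
    ∃ φ : E →L[ℝ] ℝ, ‖φ‖ ≤ K ∧ ∃ ψ : ℕ → ℕ, StrictMono ψ ∧
      ∀ s, Tendsto (fun k => Φ (ψ k) (v s)) atTop (𝓝 (φ (v s))) := by
  obtain ⟨φ, hφ, hcl⟩ := (WeakDual.isCompact_closedBall (𝕜 := ℝ) (0 : StrongDual ℝ E)
    K).exists_mapClusterPt (f := (atTop : Filter ℕ))
    (u := fun n => StrongDual.toWeakDual (Φ n)) (by
      rw [le_principal_iff, mem_map]
      refine Eventually.of_forall fun n => ?_
      simpa using hΦ n)
  refine ⟨WeakDual.toStrongDual φ, by simpa using hφ, ?_⟩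
  -- A weak-* cluster point is approached infinitely often on any finite set of vectors. Enlarging
  -- that set while shrinking the tolerance yields a convergent subsequence.
  have key : ∀ n : ℕ, ∃ᶠ k in atTop, ∀ s ∈ Finset.range (n + 1),
      |Φ k (v s) - φ (v s)| < 1 / ((n : ℝ) + 1) := by
    intro n
    have hn : (0 : ℝ) < 1 / ((n : ℝ) + 1) := by positivity
    have hU : ∀ᶠ χ : WeakDual ℝ E in 𝓝 φ, ∀ s ∈ Finset.range (n + 1),
        |χ (v s) - φ (v s)| < 1 / ((n : ℝ) + 1) := by
      rw [Filter.eventually_all_finset]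
      intro s _
      have hc : Tendsto (fun χ : WeakDual ℝ E => χ (v s)) (𝓝 φ) (𝓝 (φ (v s))) :=
        (WeakDual.eval_continuous (v s)).tendsto φ
      exact Metric.tendsto_nhds.1 hc _ hn
    exact hcl.frequently hU
  obtain ⟨ψ, hψ, h⟩ := extraction_forall_of_frequently key
  refine ⟨ψ, hψ, fun s => ?_⟩
  rw [Metric.tendsto_atTop]
  intro ε hε
  obtain ⟨N, hN⟩ := exists_nat_one_div_lt hε
  refine ⟨max N s, fun n hn => ?_⟩
  refine lt_of_lt_of_le (h n s (Finset.mem_range.2 ?_)) (le_trans ?_ hN.le)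
  · have := (le_max_right N s).trans hn
    omega
  · have : (N : ℝ) ≤ n := by exact_mod_cast (le_max_left N s).trans hn
    gcongr

/-! ### Grids of rows and positions, and their refinements. -/

/-- The space `ℓ^p(X)`. -/
abbrev LpSeq (p : ℝ≥0∞) (X : Type*) [NormedAddCommGroup X] := lp (fun _ : ℕ => X) p

/-- A family of infinitely many distinct rows of `ℕ × ℕ`, each with infinitely many marked
positions. -/
structure Grid where
  rows : ℕ → ℕ
  cols : ℕ → Set ℕ
  inj : Function.Injective rows
  inf : ∀ i, (cols (rows i)).Infinite

namespace Grid

/-- `G'` is contained in `G` and has the same first rows, up to index `q`. -/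
def Refines (q : ℕ) (G' G : Grid) : Prop :=
  (∀ m, G'.cols m ⊆ G.cols m) ∧ ∀ i ≤ q, G'.rows i = G.rows i

lemma Refines.trans {q : ℕ} {G G' G'' : Grid} (h : Refines q G'' G') (h' : Refines q G' G) :
    Refines q G'' G :=
  ⟨fun m => (h.1 m).trans (h'.1 m), fun i hi => (h.2 i hi).trans (h'.2 i hi)⟩

variable (G : Grid) (q : ℕ) (Λ : ℕ → Set ℕ) (t : ℕ → ℕ)

/-- The positions in `Λ` in the first rows of the grid. -/
def head : ℕ → Set ℕ := fun m => {k | k ∈ Λ m ∧ ∃ i ≤ q, G.rows i = m}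

/-- The positions in `Λ` in the later rows of the grid selected by `t`. -/
def tail : ℕ → Set ℕ := fun m => {k | k ∈ Λ m ∧ ∃ j, G.rows (q + 1 + t j) = m}

/-- Keep the first rows of a grid and the later rows selected by `t`, and thin them out. -/
def thin (ht : Function.Injective t) (hinf : ∀ m, (G.cols m).Infinite → (Λ m).Infinite) : Grid where
  -- The rows `0, …, q` stay in place; `t` renumbers the remaining ones from `q + 1` on.
  rows i := if i ≤ q then G.rows i else G.rows (q + 1 + t (i - (q + 1)))
  cols m := G.head q Λ m ∪ G.tail q Λ t m
  inj i j hij := by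
    simp only at hij
    split_ifs at hij with h1 h2 h2
    · exact G.inj hij
    · have := G.inj hij; omega
    · have := G.inj hij; omega
    · have := G.inj hij
      have : i - (q + 1) = j - (q + 1) := ht (by omega)
      omega
  inf i := by
    split_ifs with h
    · refine ((hinf _ (G.inf i)).mono fun k hk => ?_)
      exact Or.inl ⟨hk, i, h, rfl⟩
    · refine ((hinf _ (G.inf (q + 1 + t (i - (q + 1))))).mono fun k hk => ?_)
      exact Or.inr ⟨hk, _, rfl⟩

lemma thin_refines (ht : Function.Injective t)
    (hinf : ∀ m, (G.cols m).Infinite → (Λ m).Infinite) (hΛ : ∀ m, Λ m ⊆ G.cols m) :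
    Refines q (G.thin q Λ t ht hinf) G :=
  ⟨fun m => Set.union_subset (fun _ hk => hΛ m hk.1) fun _ hk => hΛ m hk.1,
    fun _ hi => if_pos hi⟩

lemma disjoint_head_tail (m : ℕ) : Disjoint (G.head q Λ m) (G.tail q Λ t m) := by
  rw [Set.disjoint_left]
  rintro k ⟨-, i, hi, h⟩ ⟨-, j, h'⟩
  have := G.inj (h.trans h'.symm)
  omega

end Grid

/-! ### Refining a grid until a functional or a vector is small on it. -/

namespace CoordSystem

variable {X : Type*} [NormedAddCommGroup X] [NormedSpace ℝ X] (S : CoordSystem X)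
  (p : ℝ≥0∞) [hp : Fact (1 ≤ p)]

/-- The coordinate functional of `ℓ^p(X)` in row `i` at position `k`. -/
def coordL (i k : ℕ) : LpSeq p X →L[ℝ] ℝ := S.c k ∘L lp.evalCLM ℝ (fun _ : ℕ => X) p i

/-- The unit vector of `ℓ^p(X)` in row `i` at position `k`. -/
def vecL (i k : ℕ) : LpSeq p X := lp.single p i (S.e k)

/-- The coordinate projection of `ℓ^p(X)` onto the positions in `R`. -/
def projL (R : ℕ → Set ℕ) : LpSeq p X →L[ℝ] LpSeq p X :=
  lpOp p Set.univ id (Set.injOn_id _) (fun i => S.proj (R i)) S.C S.C_pos.le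
    fun i x => S.proj_le (R i) x

variable {p}

lemma coordL_apply (i k : ℕ) (x : LpSeq p X) : S.coordL p i k x = S.c k (x i) := rfl

include hp in
omit [NormedSpace ℝ X] in
lemma norm_apply_le (x : LpSeq p X) (i : ℕ) : ‖x i‖ ≤ ‖x‖ :=
  lp.norm_apply_le_norm (zero_lt_one.trans_le hp.out).ne' x i

lemma norm_coordL_le (i k : ℕ) : ‖S.coordL p i k‖ ≤ S.C :=
  ContinuousLinearMap.opNorm_le_bound _ S.C_pos.le fun x =>
    (S.norm_c k (x i)).trans (mul_le_mul_of_nonneg_left (norm_apply_le x i) S.C_pos.le)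

lemma ext_coordL {x y : LpSeq p X} (h : ∀ i k, S.coordL p i k x = S.coordL p i k y) : x = y :=
  lp.ext (funext fun i => S.ext _ _ fun k => h i k)

lemma coordL_vecL (i k i' k' : ℕ) :
    S.coordL p i k (S.vecL p i' k') = if i = i' ∧ k = k' then 1 else 0 := by
  rw [coordL_apply, vecL]
  rcases eq_or_ne i i' with rfl | h
  · rw [lp.single_apply_self, c_e]; simp
  · rw [lp.single_apply_ne _ _ _ h, map_zero]; simp [h]

lemma norm_vecL (i k : ℕ) : ‖S.vecL p i k‖ = 1 := by
  rw [vecL, lp.norm_single (zero_lt_one.trans_le hp.out), S.norm_e]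

lemma projL_apply (R : ℕ → Set ℕ) (x : LpSeq p X) (i : ℕ) :
    S.projL p R x i = S.proj (R i) (x i) := lpOp_apply_of_mem _ _ _ _ _ _ _ _ (Set.mem_univ i)

lemma projL_le (R : ℕ → Set ℕ) (x : LpSeq p X) : ‖S.projL p R x‖ ≤ S.C * ‖x‖ :=
  lpOp_le _ _ _ _ _ _ _ _

lemma coordL_projL (R : ℕ → Set ℕ) (x : LpSeq p X) (i k : ℕ) :
    S.coordL p i k (S.projL p R x) = (R i).indicator 1 k * S.coordL p i k x := by
  rw [coordL_apply, projL_apply, c_proj, coordL_apply]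

lemma projL_projL_of_subset {R R' : ℕ → Set ℕ} (h : ∀ m, R' m ⊆ R m) (x : LpSeq p X) :
    S.projL p R' (S.projL p R x) = S.projL p R' x :=
  lp.ext (funext fun i => by
    rw [projL_apply, projL_apply, projL_apply, S.proj_proj_of_subset (h i)])

lemma tendsto_apply_vecL (φ : LpSeq p X →L[ℝ] ℝ) (i : ℕ) :
    Tendsto (fun k => φ (S.vecL p i k)) atTop (𝓝 0) :=
  S.tendsto_apply_e (φ ∘L lp.singleContinuousLinearMap ℝ (fun _ : ℕ => X) p i)

lemma proj_empty (x : X) : S.proj ∅ x = 0 := by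
  refine S.ext _ _ fun j => ?_
  rw [c_proj]; simp

lemma projL_union {R R₁ R₂ : ℕ → Set ℕ} (h : ∀ m, R m = R₁ m ∪ R₂ m)
    (hd : ∀ m, Disjoint (R₁ m) (R₂ m)) (x : LpSeq p X) :
    S.projL p R x = S.projL p R₁ x + S.projL p R₂ x := by
  refine S.ext_coordL fun i k => ?_
  rw [map_add, coordL_projL, coordL_projL, coordL_projL, h, Set.indicator_union_of_disjoint (hd i)]
  ring

lemma projL_head (G : Grid) (q : ℕ) (Λ : ℕ → Set ℕ) (x : LpSeq p X) :
    S.projL p (G.head q Λ) x = ∑ i ∈ Finset.range (q + 1),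
      lp.single p (G.rows i) (S.proj (Λ (G.rows i)) (x (G.rows i))) := by
  refine lp.ext (funext fun m => ?_)
  rw [projL_apply, lp.coeFn_sum, Finset.sum_apply]
  by_cases h : ∃ i ≤ q, G.rows i = m
  · obtain ⟨i, hi, rfl⟩ := h
    rw [Finset.sum_eq_single i, lp.single_apply_self]
    · congr 2
      ext k
      exact ⟨fun hk => hk.1, fun hk => ⟨hk, i, hi, rfl⟩⟩
    · intro j _ hj
      exact lp.single_apply_ne _ _ _ (G.inj.ne hj.symm)
    · intro h
      exact absurd (Finset.mem_range.2 (by omega)) h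
  · have : G.head q Λ m = ∅ := by
      ext k
      exact ⟨fun hk => h hk.2, fun hk => hk.elim⟩
    rw [this, proj_empty, Finset.sum_eq_zero]
    intro i hi
    refine lp.single_apply_ne _ _ _ ?_
    rintro rfl
    exact h ⟨i, by have := Finset.mem_range.1 hi; omega, rfl⟩

lemma projL_thin (G : Grid) (q : ℕ) (Λ : ℕ → Set ℕ) (t : ℕ → ℕ) (ht) (hinf) (x : LpSeq p X) :
    S.projL p (G.thin q Λ t ht hinf).cols x
      = S.projL p (G.head q Λ) x + S.projL p (G.tail q Λ t) x :=
  S.projL_union (fun _ => rfl) (G.disjoint_head_tail q Λ t) x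

/-- The tolerance may vary with the row: summable for p < ∞, constant for p = ∞. Rows with finitely
many marked positions are emptied, so that the estimate holds for every `m`. -/
lemma exists_thin_functional (φ : LpSeq p X →L[ℝ] ℝ) (G : Grid) {ε : ℕ → ℝ} (hε : ∀ m, 0 < ε m) :
    ∃ Λ : ℕ → Set ℕ, (∀ m, Λ m ⊆ G.cols m) ∧ (∀ m, (G.cols m).Infinite → (Λ m).Infinite) ∧
      ∀ m x, |φ (lp.single p m (S.proj (Λ m) x))| ≤ ε m * ‖x‖ := by
  have key : ∀ m, ∃ Λ ⊆ G.cols m, ((G.cols m).Infinite → Λ.Infinite) ∧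
      ∀ x, |φ (lp.single p m (S.proj Λ x))| ≤ ε m * ‖x‖ := by
    intro m
    by_cases h : (G.cols m).Infinite
    · obtain ⟨Λ, h1, h2, h3⟩ := S.exists_abs_proj_le
        (φ ∘L lp.singleContinuousLinearMap ℝ (fun _ : ℕ => X) p m) h (hε m)
      exact ⟨Λ, h1, fun _ => h2, h3⟩
    · refine ⟨∅, Set.empty_subset _, fun h' => absurd h' h, fun x => ?_⟩
      rw [proj_empty, lp.single_zero, map_zero, abs_zero]
      exact mul_nonneg (hε m).le (norm_nonneg x)
  choose Λ h1 h2 h3 using key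
  exact ⟨Λ, h1, h2, h3⟩

/-- For p < ∞ a vector is the norm-convergent sum of its rows, so thinning each row with errors
summing to `η` suffices and no row is dropped. -/
lemma exists_refines_functional_of_ne_top (hpt : p ≠ ∞) (φ : LpSeq p X →L[ℝ] ℝ) (G : Grid) (q : ℕ)
    {η : ℝ} (hη : 0 < η) :
    ∃ G' : Grid, G'.Refines q G ∧ ∀ x, |φ (S.projL p G'.cols x)| ≤ η * ‖x‖ := by
  obtain ⟨Λ, h1, h2, h3⟩ := S.exists_thin_functional φ G (ε := fun m => η / 2 / 2 ^ m)
    fun m => by positivity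
  refine ⟨⟨G.rows, Λ, G.inj, fun i => h2 _ (G.inf i)⟩, ⟨h1, fun _ _ => rfl⟩, fun x => ?_⟩
  have hs := (lp.hasSum_single hpt (S.projL p Λ x)).mapL φ
  have hg : HasSum (fun m : ℕ => η / 2 / 2 ^ m * ‖x‖) (η * ‖x‖) :=
    (hasSum_geometric_two' η).mul_right _
  rw [← Real.norm_eq_abs, ← hs.tsum_eq]
  refine tsum_of_norm_bounded hg fun m => ?_
  rw [Real.norm_eq_abs, projL_apply]
  exact (h3 m _).trans (mul_le_mul_of_nonneg_left (norm_apply_le x m) (by positivity))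

lemma abs_projL_head_le (φ : LpSeq p X →L[ℝ] ℝ) (G : Grid) (q : ℕ) (Λ : ℕ → Set ℕ) {ε : ℝ}
    (hε : 0 ≤ ε) (h : ∀ m x, |φ (lp.single p m (S.proj (Λ m) x))| ≤ ε * ‖x‖) (x : LpSeq p X) :
    |φ (S.projL p (G.head q Λ) x)| ≤ (q + 1) * ε * ‖x‖ := by
  rw [projL_head, map_sum]
  refine (Finset.abs_sum_le_sum_abs _ _).trans
    ((Finset.sum_le_card_nsmul _ _ (ε * ‖x‖) fun i _ => ?_).trans_eq ?_)
  · exact (h _ _).trans (mul_le_mul_of_nonneg_left (norm_apply_le x _) hε)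
  · simp; ring

lemma norm_projL_head_le (G : Grid) (q : ℕ) (Λ : ℕ → Set ℕ) {ε : ℝ} (y : LpSeq p X)
    (h : ∀ i ≤ q, ‖S.proj (Λ (G.rows i)) (y (G.rows i))‖ ≤ ε) :
    ‖S.projL p (G.head q Λ) y‖ ≤ (q + 1) * ε := by
  rw [projL_head]
  refine (norm_sum_le _ _).trans
    ((Finset.sum_le_card_nsmul _ _ ε fun i hi => ?_).trans_eq ?_)
  · rw [lp.norm_single (zero_lt_one.trans_le hp.out)]
    exact h i (by have := Finset.mem_range.1 hi; omega)
  · simp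

/-- A functional on a space in which the partial sums of `y` are bounded cannot be bounded below
by a positive constant on all `y j`. -/
lemma exists_apply_lt {E : Type*} [NormedAddCommGroup E] [NormedSpace ℝ E] (φ : E →L[ℝ] ℝ)
    (y : ℕ → E) {K η : ℝ} (hη : 0 < η) (hy : ∀ N, ‖∑ j ∈ Finset.range N, y j‖ ≤ K) :
    ∃ j, φ (y j) < η := by
  by_contra! h
  obtain ⟨N, hN⟩ := exists_nat_gt (‖φ‖ * K / η)
  have h1 : N * η ≤ φ (∑ j ∈ Finset.range N, y j) := by
    rw [map_sum]
    simpa using Finset.card_nsmul_le_sum (Finset.range N) (fun j => φ (y j)) η fun j _ => h j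
  have h2 : φ (∑ j ∈ Finset.range N, y j) ≤ ‖φ‖ * K :=
    (le_abs_self _).trans ((φ.le_opNorm _).trans (mul_le_mul_of_nonneg_left (hy N) (norm_nonneg _)))
  rw [div_lt_iff₀ hη] at hN
  linarith

omit [NormedSpace ℝ X] in
lemma norm_sum_le_of_disjoint {x : ℕ → LpSeq ∞ X} {K : ℝ} (hK : 0 ≤ K)
    (hx : ∀ j, ‖x j‖ ≤ K) (hd : ∀ i j m, x i m ≠ 0 → x j m ≠ 0 → i = j) (N : ℕ) :
    ‖∑ j ∈ Finset.range N, x j‖ ≤ K := by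
  refine lp.norm_le_of_forall_le hK fun m => ?_
  rw [lp.coeFn_sum, Finset.sum_apply]
  by_cases h : ∃ j ∈ Finset.range N, x j m ≠ 0
  · obtain ⟨j, hj, hne⟩ := h
    rw [Finset.sum_eq_single_of_mem j hj fun i _ hij => by
      by_contra h0
      exact hij (hd i j m h0 hne)]
    exact (lp.norm_apply_le_norm ENNReal.top_ne_zero (x j) m).trans (hx j)
  · push Not at h
    rw [Finset.sum_eq_zero h, norm_zero]
    exact hK

/-- For p = ∞ the rows of a vector need not sum to it in norm. The first `q + 1` rows are thinned
individually, while the later ones are split into infinitely many disjoint infinite families. On one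
family the functional must be small: otherwise disjointly supported vectors with bounded partial
sums would violate `exists_apply_lt`. -/
lemma exists_refines_functional_top (φ : LpSeq ∞ X →L[ℝ] ℝ) (G : Grid) (q : ℕ)
    {η : ℝ} (hη : 0 < η) :
    ∃ G' : Grid, G'.Refines q G ∧ ∀ x, |φ (S.projL ∞ G'.cols x)| ≤ η * ‖x‖ := by
  obtain ⟨Λ, h1, h2, h3⟩ := S.exists_thin_functional φ G (ε := fun m => η / (2 * (q + 1)))
    fun m => by positivity
  have ht : ∀ j, Function.Injective (Nat.pair j) := fun j a b hab => (Nat.pair_eq_pair.1 hab).2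
  obtain ⟨j, hj⟩ : ∃ j, ∀ x, |φ (S.projL ∞ (G.tail q Λ (Nat.pair j)) x)| ≤ η / 2 * ‖x‖ := by
    by_contra! h
    choose x hx using h
    have hx0 : ∀ j, ‖x j‖ ≠ 0 := fun j h0 => by
      have := hx j
      rw [norm_eq_zero.1 h0, map_zero, map_zero] at this
      simp at this
    set a : ℕ → ℝ := fun j => φ (S.projL ∞ (G.tail q Λ (Nat.pair j)) (x j)) with ha
    -- Normalization and the sign turn the lower bound on `|a j|` into `φ (y j) > η / 2`.
    set y : ℕ → LpSeq ∞ X := fun j => S.projL ∞ (G.tail q Λ (Nat.pair j))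
      ((SignType.sign (a j) * ‖x j‖⁻¹ : ℝ) • x j) with hy
    obtain ⟨j, hj⟩ := exists_apply_lt φ y (K := S.C) (half_pos hη) (norm_sum_le_of_disjoint
      S.C_pos.le (fun j => (S.projL_le _ _).trans (by
        refine mul_le_of_le_one_right S.C_pos.le ?_
        rw [norm_smul, norm_mul, norm_inv, norm_norm, mul_assoc, inv_mul_cancel₀ (hx0 j), mul_one]
        rcases lt_trichotomy (a j) 0 with h | h | h <;> simp [h])) fun i j m hi hj => by
        have key : ∀ i, y i m ≠ 0 → ∃ k, G.rows (q + 1 + Nat.pair i k) = m := by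
          intro i hi
          by_contra hm
          refine hi ?_
          have : G.tail q Λ (Nat.pair i) m = ∅ := by
            ext k
            exact ⟨fun hk => hm hk.2, fun hk => hk.elim⟩
          rw [hy, projL_apply, this, proj_empty]
        obtain ⟨k, hk⟩ := key i hi
        obtain ⟨l, hl⟩ := key j hj
        have := G.inj (hk.trans hl.symm)
        exact (Nat.pair_eq_pair.1 (by omega : Nat.pair i k = Nat.pair j l)).1)
    have hxj := hx j
    have hpos : 0 < ‖x j‖ := lt_of_le_of_ne (norm_nonneg _) (hx0 j).symm
    have : φ (y j) = |a j| * ‖x j‖⁻¹ := by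
      simp only [hy, map_smul, smul_eq_mul]
      rw [mul_right_comm, mul_comm (SignType.sign (a j) : ℝ)]
      change a j * _ * _ = _
      rw [self_mul_sign]
    rw [this, ← div_eq_mul_inv, div_lt_iff₀ hpos] at hj
    exact absurd hxj (not_lt.2 hj.le)
  refine ⟨G.thin q Λ (Nat.pair j) (ht j) h2, G.thin_refines q Λ _ _ _ h1, fun x => ?_⟩
  rw [projL_thin, map_add]
  refine (abs_add_le _ _).trans ((add_le_add (S.abs_projL_head_le φ G q Λ (by positivity) h3 x)
    (hj x)).trans_eq ?_)
  field_simp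
  ring

lemma exists_refines_functional (φ : LpSeq p X →L[ℝ] ℝ) (G : Grid) (q : ℕ)
    {η : ℝ} (hη : 0 < η) :
    ∃ G' : Grid, G'.Refines q G ∧ ∀ x, |φ (S.projL p G'.cols x)| ≤ η * ‖x‖ := by
  rcases eq_or_ne p ∞ with rfl | hpt
  · exact S.exists_refines_functional_top φ G q hη
  · exact S.exists_refines_functional_of_ne_top hpt φ G q hη

/-- For p < ∞, `y` is within `ε / S.C` of a vector supported on finitely many rows, and a large `N`
skips all of these. -/
lemma exists_tail_le_of_ne_top (hpt : p ≠ ∞) (G : Grid) (q : ℕ) (Λ : ℕ → Set ℕ) (y : LpSeq p X)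
    {ε : ℝ} (hε : 0 < ε) : ∃ N, ‖S.projL p (G.tail q Λ (N + ·)) y‖ ≤ ε := by
  have hs := lp.hasSum_single hpt y
  have hC := S.C_pos
  obtain ⟨s, hs⟩ := ((Metric.tendsto_nhds.1 hs) (ε / S.C) (by positivity)).exists
  have hrows : ∀ᶠ j in atTop, G.rows j ∉ s := by
    rw [← Nat.cofinite_eq_atTop]
    exact G.inj.tendsto_cofinite.eventually s.finite_toSet.eventually_cofinite_notMem
  obtain ⟨N, hN⟩ := eventually_atTop.1 hrows
  refine ⟨N, ?_⟩
  set z := ∑ i ∈ s, lp.single (E := fun _ : ℕ => X) p i (y i)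
  have hz : S.projL p (G.tail q Λ (N + ·)) z = 0 := by
    refine lp.ext (funext fun m => ?_)
    rw [projL_apply]
    by_cases hm : m ∈ s
    · have : G.tail q Λ (N + ·) m = ∅ := by
        ext k
        refine ⟨fun ⟨_, j, hj⟩ => hN (q + 1 + (N + j)) (by omega) (hj ▸ hm), fun hk => hk.elim⟩
      rw [this, proj_empty]; rfl
    · have : z m = 0 := by
        rw [lp.coeFn_sum, Finset.sum_apply]
        refine Finset.sum_eq_zero fun i hi => lp.single_apply_ne _ _ _ ?_
        rintro rfl
        exact hm hi
      rw [this, map_zero]; rfl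
  rw [← sub_zero (S.projL p _ y), ← hz, ← map_sub]
  refine (S.projL_le _ _).trans ?_
  rw [dist_comm, dist_eq_norm, lt_div_iff₀ hC] at hs
  rw [mul_comm]
  exact hs.le

variable [CompleteSpace X]

/-- `exists_proj_le` is applied in each row. The first `q + 1` rows are added by the triangle
inequality. The later rows count as one more term: for p < ∞ their norm is made small by starting
late, and for p = ∞ it is a supremum in which the row limits are eventually at most `2 * δ`. -/
lemma exists_refines_vector : ∃ L : ℝ, 0 ≤ L ∧ ∀ (y : LpSeq p X) (G : Grid) (q : ℕ) (z : ℕ → ℝ)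
    (a δ η : ℝ), (∀ m, Tendsto (fun k => S.c k (y m)) (atTop ⊓ 𝓟 (G.cols m)) (𝓝 (z m))) →
    Tendsto (fun i => z (G.rows i)) atTop (𝓝 a) → (∀ i ≤ q, |z (G.rows i)| ≤ δ) → |a| ≤ δ →
    0 < δ → 0 < η →
    ∃ G' : Grid, G'.Refines q G ∧ ‖S.projL p G'.cols y‖ ≤ (q + 2) * (η + L * δ) := by
  obtain ⟨L, hL, hS⟩ := S.exists_proj_le
  refine ⟨L * 2, by positivity, fun y G q z a δ η hy hz hzδ ha hδ hη => ?_⟩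
  have key : ∀ m, ∃ Λ ⊆ G.cols m, ((G.cols m).Infinite → Λ.Infinite) ∧
      ‖S.proj Λ (y m)‖ ≤ η + L * |z m| := by
    intro m
    by_cases h : (G.cols m).Infinite
    · obtain ⟨Λ, h1, h2, h3⟩ := hS (y m) (G.cols m) (z m) h (hy m) η hη
      exact ⟨Λ, h1, fun _ => h2, h3⟩
    · refine ⟨∅, Set.empty_subset _, fun h' => absurd h' h, ?_⟩
      rw [proj_empty, norm_zero]
      positivity
  choose Λ h1 h2 h3 using key
  obtain ⟨N, hN⟩ : ∃ N, ‖S.projL p (G.tail q Λ (N + ·)) y‖ ≤ η + L * 2 * δ := by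
    rcases eq_or_ne p ∞ with rfl | hpt
    · have hz2 : ∀ᶠ i in atTop, |z (G.rows i)| ≤ 2 * δ := by
        filter_upwards [Metric.tendsto_nhds.1 hz δ hδ] with i hi
        have := abs_sub_abs_le_abs_sub (z (G.rows i)) a
        have hi' : |z (G.rows i) - a| < δ := hi
        linarith
      obtain ⟨N, hN⟩ := eventually_atTop.1 hz2
      refine ⟨N, lp.norm_le_of_forall_le (by positivity) fun m => ?_⟩
      rw [projL_apply]
      by_cases hm : ∃ j, G.rows (q + 1 + (N + j)) = m
      · have : G.tail q Λ (N + ·) m = Λ m := by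
          ext k
          exact ⟨fun hk => hk.1, fun hk => ⟨hk, hm⟩⟩
        rw [this]
        obtain ⟨j, rfl⟩ := hm
        refine (h3 _).trans ?_
        have := mul_le_mul_of_nonneg_left (hN (q + 1 + (N + j)) (by omega)) hL
        linarith
      · have : G.tail q Λ (N + ·) m = ∅ := by
          ext k
          exact ⟨fun hk => hm hk.2, fun hk => hk.elim⟩
        rw [this, proj_empty, norm_zero]
        positivity
    · obtain ⟨N, hN⟩ := S.exists_tail_le_of_ne_top hpt G q Λ y hη
      exact ⟨N, hN.trans (le_add_of_nonneg_right (by positivity))⟩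
  refine ⟨G.thin q Λ (N + ·) (add_right_injective N) h2, G.thin_refines q Λ _ _ _ h1, ?_⟩
  rw [projL_thin]
  refine (norm_add_le _ _).trans ((add_le_add (S.norm_projL_head_le G q Λ (ε := η + L * 2 * δ) y
    fun i hi => (h3 _).trans ?_) hN).trans_eq (by ring))
  have := mul_le_mul_of_nonneg_left (hzδ i hi) hL
  have := mul_nonneg hL hδ.le
  linarith

end CoordSystem

/-! ### Inductive selection of positions for an operator. -/

namespace CoordSystem

variable {X : Type*} [NormedAddCommGroup X] [NormedSpace ℝ X] (S : CoordSystem X)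
  {p : ℝ≥0∞} [hp : Fact (1 ≤ p)]

lemma tendsto_range_of_strictMono {ψ : ℕ → ℕ} (hψ : StrictMono ψ) {f : ℕ → ℝ} {a : ℝ}
    (h : Tendsto (fun n => f (ψ n)) atTop (𝓝 a)) :
    Tendsto f (atTop ⊓ 𝓟 (Set.range ψ)) (𝓝 a) := by
  intro U hU
  obtain ⟨N, hN⟩ := eventually_atTop.1 (h.eventually hU)
  change ∀ᶠ l in atTop ⊓ 𝓟 (Set.range ψ), f l ∈ U
  rw [eventually_inf_principal]
  filter_upwards [eventually_ge_atTop (ψ N)] with l hl hr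
  obtain ⟨n, rfl⟩ := hr
  exact hN n (hψ.le_iff_le.1 hl)

/-- There are a grid, and functionals `φ m` and `φ'`, such that the coordinates of the images of
the unit vectors converge along the rows of the grid to the values of the `φ m`, which in turn
converge to the values of `φ'`. -/
lemma exists_grid_tendsto (T : LpSeq p X →L[ℝ] LpSeq p X) :
    ∃ (G₀ : Grid) (φ : ℕ → LpSeq p X →L[ℝ] ℝ) (φ' : LpSeq p X →L[ℝ] ℝ),
      (∀ i k m, Tendsto (fun l => S.c l (T (S.vecL p i k) m)) (atTop ⊓ 𝓟 (G₀.cols m))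
        (𝓝 (φ m (S.vecL p i k)))) ∧
      ∀ G : Grid, (∀ m, G.cols m ⊆ G₀.cols m) → ∀ i k,
        Tendsto (fun j => φ (G.rows j) (S.vecL p i k)) atTop (𝓝 (φ' (S.vecL p i k))) := by
  have h1 : ∀ m, ∃ φ : LpSeq p X →L[ℝ] ℝ, ‖φ‖ ≤ S.C * ‖T‖ ∧ ∃ ψ : ℕ → ℕ, StrictMono ψ ∧
      ∀ s : ℕ, Tendsto (fun k => (S.coordL p m (ψ k) ∘L T) (S.vecL p s.unpair.1 s.unpair.2)) atTop
        (𝓝 (φ (S.vecL p s.unpair.1 s.unpair.2))) := fun m =>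
    exists_tendsto_subseq_functional (fun k => S.coordL p m k ∘L T) (fun k =>
      (ContinuousLinearMap.opNorm_comp_le _ _).trans
        (mul_le_mul_of_nonneg_right (S.norm_coordL_le m k) (norm_nonneg _))) _
  choose φ hφ ψ hψ hlim using h1
  obtain ⟨φ', -, μ, hμ, hlim'⟩ := exists_tendsto_subseq_functional φ hφ
    fun s : ℕ => S.vecL p s.unpair.1 s.unpair.2
  -- Emptying every row outside the range of `μ` forces the rows of any subgrid into that range, so
  -- convergence along `μ` passes to subgrids.
  refine ⟨⟨μ, fun m => {l | l ∈ Set.range (ψ m) ∧ m ∈ Set.range μ}, hμ.injective, fun i => ?_⟩,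
    φ, φ', fun i k m => ?_, fun G hG i k => ?_⟩
  · exact (Set.infinite_range_of_injective (hψ (μ i)).injective).mono fun l hl => ⟨hl, i, rfl⟩
  · have := hlim m (Nat.pair i k)
    rw [Nat.unpair_pair] at this
    exact (tendsto_range_of_strictMono (hψ m) (f := fun l => S.c l (T (S.vecL p i k) m))
      this).mono_left (inf_le_inf_left _ (principal_mono.2 fun l hl => hl.1))
  · have := hlim' (Nat.pair i k)
    rw [Nat.unpair_pair] at this
    refine (tendsto_range_of_strictMono hμ (f := fun m => φ m (S.vecL p i k)) this).comp ?_
    refine tendsto_inf.2 ⟨?_, tendsto_principal.2 (Eventually.of_forall fun j => ?_)⟩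
    · have := G.inj.tendsto_cofinite
      rwa [Nat.cofinite_eq_atTop] at this
    · obtain ⟨l, hl⟩ := (G.inf j).nonempty
      exact (hG _ hl).2

variable [CompleteSpace X]

/-- Weak nullity of the unit vectors in a row makes all row limits for the first rows, and the limit
of the row limits, small at a late `n`. The grid can then be refined against the image of that unit
vector, and afterwards against the coordinate functional composed with `T`. -/
lemma exists_step (T : LpSeq p X →L[ℝ] LpSeq p X) :
    ∃ G₀ : Grid, ∀ G : Grid, (∀ m, G.cols m ⊆ G₀.cols m) → ∀ q, ∀ i ≤ q, ∀ (N : ℕ) (η : ℝ), 0 < η →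
      ∃ n > N, n ∈ G.cols (G.rows i) ∧ ∃ G' : Grid, G'.Refines q G ∧
        (∀ x, |S.coordL p (G.rows i) n (T (S.projL p G'.cols x))| ≤ η * ‖x‖) ∧
        ‖S.projL p G'.cols (T (S.vecL p (G.rows i) n))‖ ≤ η := by
  obtain ⟨G₀, φ, φ', h1, h2⟩ := S.exists_grid_tendsto T
  obtain ⟨L, hL, hvec⟩ := S.exists_refines_vector (p := p)
  refine ⟨G₀, fun G hG q i hi N η hη => ?_⟩
  have hC := S.C_pos
  -- The vector refinement costs `(q + 2) * (η' + L * δ) ≤ (q + 2) * 2 * η'`, and the second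
  -- refinement costs a further factor `S.C`.
  set η' : ℝ := η / (S.C * (2 * (q + 2))) with hη'
  have hη'0 : 0 < η' := by positivity
  set δ : ℝ := η' / (L + 1) with hδ
  have hδ0 : 0 < δ := by positivity
  have hLδ : L * δ ≤ η' := by
    rw [hδ, mul_div_assoc', div_le_iff₀ (by positivity)]
    nlinarith
  have hev : ∀ χ : LpSeq p X →L[ℝ] ℝ, ∀ᶠ n in atTop, |χ (S.vecL p (G.rows i) n)| ≤ δ := fun χ => by
    filter_upwards [Metric.tendsto_nhds.1 (S.tendsto_apply_vecL χ (G.rows i)) δ hδ0] with n hn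
    rw [Real.dist_0_eq_abs] at hn
    exact hn.le
  have hev2 : ∀ᶠ n in atTop, ∀ j ∈ Finset.range (q + 1),
      |φ (G.rows j) (S.vecL p (G.rows i) n)| ≤ δ := by
    rw [Filter.eventually_all_finset]
    exact fun j _ => hev _
  obtain ⟨n, hnG, hn1, hn2, hn3⟩ := ((Nat.frequently_atTop_iff_infinite.2 (G.inf i)).and_eventually
    (hev2.and ((hev φ').and (eventually_gt_atTop N)))).exists
  obtain ⟨G₁, hG₁, hG₁'⟩ := hvec (T (S.vecL p (G.rows i) n)) G q
    (fun m => φ m (S.vecL p (G.rows i) n)) (φ' (S.vecL p (G.rows i) n)) δ η'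
    (fun m => (h1 _ _ m).mono_left (inf_le_inf_left _ (principal_mono.2 (hG m))))
    (h2 G hG _ _) (fun j hj => hn1 j (Finset.mem_range.2 (by omega))) hn2 hδ0 hη'0
  obtain ⟨G₂, hG₂, hG₂'⟩ := S.exists_refines_functional (S.coordL p (G.rows i) n ∘L T) G₁ q hη
  refine ⟨n, hn3, hnG, G₂, hG₂.trans hG₁, hG₂', ?_⟩
  rw [← S.projL_projL_of_subset hG₂.1]
  refine (S.projL_le _ _).trans ?_
  calc S.C * ‖S.projL p G₁.cols (T (S.vecL p (G.rows i) n))‖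
      ≤ S.C * ((q + 2) * (η' + η')) := by
        refine mul_le_mul_of_nonneg_left (hG₁'.trans ?_) hC.le
        exact mul_le_mul_of_nonneg_left (by linarith) (by positivity)
    _ = η := by
        rw [hη']; field_simp; norm_num

/-- Inductive choice of positions on which an operator is almost diagonal. -/
lemma exists_positions (T : LpSeq p X →L[ℝ] LpSeq p X) {η : ℕ → ℝ} (hη : ∀ s, 0 < η s) :
    ∃ r n : ℕ → ℕ, Function.Injective r ∧ StrictMono n ∧ ∀ s : ℕ, ∃ R : ℕ → Set ℕ,
      (∀ s' : ℕ, s < s' → n s' ∈ R (r s'.unpair.1)) ∧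
      (∀ x, |S.coordL p (r s.unpair.1) (n s) (T (S.projL p R x))| ≤ η s * ‖x‖) ∧
      ‖S.projL p R (T (S.vecL p (r s.unpair.1) (n s)))‖ ≤ η s := by
  obtain ⟨G₀, hstep⟩ := S.exists_step T
  have key : ∀ (s : ℕ) (a : {G : Grid // ∀ m, G.cols m ⊆ G₀.cols m} × ℕ),
      ∃ b : {G : Grid // ∀ m, G.cols m ⊆ G₀.cols m} × ℕ, a.2 < b.2 ∧
        b.2 ∈ a.1.1.cols (a.1.1.rows s.unpair.1) ∧ Grid.Refines s b.1.1 a.1.1 ∧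
        (∀ x, |S.coordL p (a.1.1.rows s.unpair.1) b.2 (T (S.projL p b.1.1.cols x))| ≤ η s * ‖x‖) ∧
        ‖S.projL p b.1.1.cols (T (S.vecL p (a.1.1.rows s.unpair.1) b.2))‖ ≤ η s := by
    intro s a
    obtain ⟨n, hn, hn', G', hG', h1, h2⟩ := hstep a.1.1 a.1.2 s s.unpair.1 (Nat.unpair_left_le s)
      a.2 (η s) (hη s)
    exact ⟨⟨⟨G', fun m => (hG'.1 m).trans (a.1.2 m)⟩, n⟩, hn, hn', hG', h1, h2⟩
  choose nxt k1 k2 k3 k4 k5 using key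
  -- Stage `s` selects a position in row `s.unpair.1 ≤ s` and preserves rows `0, …, s`; row `i` is
  -- therefore final from stage `i` on. The recorded number is the last position selected.
  let st : ℕ → {G : Grid // ∀ m, G.cols m ⊆ G₀.cols m} × ℕ := fun s =>
    Nat.rec (⟨G₀, fun _ => subset_rfl⟩, 0) (fun s a => nxt s a) s
  have hst : ∀ s, st (s + 1) = nxt s (st s) := fun _ => rfl
  have hrows : ∀ i s, i ≤ s → (st s).1.1.rows i = (st i).1.1.rows i := by
    intro i s his
    induction s, his using Nat.le_induction with
    | base => rfl
    | succ s hs ih => rw [hst, (k3 s (st s)).2 i hs, ih]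
  have hcols : ∀ s s', s ≤ s' → ∀ m, (st s').1.1.cols m ⊆ (st s).1.1.cols m := by
    intro s s' h m
    induction s', h using Nat.le_induction with
    | base => exact subset_rfl
    | succ s' hs ih => rw [hst]; exact ((k3 s' (st s')).1 m).trans ih
  refine ⟨fun i => (st i).1.1.rows i, fun s => (st (s + 1)).2, fun i j hij => ?_,
    strictMono_nat_of_lt_succ fun s => k1 (s + 1) (st (s + 1)), fun s => ?_⟩
  · simp only at hij
    rw [← hrows i (max i j) (le_max_left _ _), ← hrows j (max i j) (le_max_right _ _)] at hij
    exact (st (max i j)).1.1.inj hij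
  · refine ⟨(st (s + 1)).1.1.cols, fun s' hs' => ?_, ?_, ?_⟩
    · refine hcols _ _ hs' _ ?_
      beta_reduce
      rw [← hrows _ s' (Nat.unpair_left_le s')]
      exact k2 s' (st s')
    · beta_reduce
      rw [← hrows _ s (Nat.unpair_left_le s)]
      exact k4 s (st s)
    · beta_reduce
      rw [← hrows _ s (Nat.unpair_left_le s)]
      exact k5 s (st s)

omit [CompleteSpace X]

/-! ### Complemented copies of ℓ^p(X) on selected rows and positions. -/

section Reindex

variable (p) (r : ℕ → ℕ) (hr : Function.Injective r) (ν : ℕ → ℕ → ℕ) (hν : ∀ i, StrictMono (ν i))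

/-- The operator reading the rows `r i` at the positions `ν i k`. -/
def pullL : LpSeq p X →L[ℝ] LpSeq p X :=
  lpOp p Set.univ r hr.injOn (fun i => S.compressMap (ν i) (hν i)) S.C S.C_pos.le
    fun i x => S.compressMap_le (ν i) (hν i) x

/-- The operator placing the coordinates of the `i`-th row in row `r i` at the positions
`ν i k`. -/
def pushL : LpSeq p X →L[ℝ] LpSeq p X :=
  lpOp p (Set.range r) (Function.invFun r)
    (fun a ha b hb hab => by
      rw [← Function.invFun_eq ha, ← Function.invFun_eq hb, hab])
    (fun m => S.spreadMap (ν (Function.invFun r m)) (hν _)) S.C S.C_pos.le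
    fun i x => S.spreadMap_le _ (hν _) x

variable {p}

lemma pullL_le (x : LpSeq p X) : ‖S.pullL p r hr ν hν x‖ ≤ S.C * ‖x‖ := lpOp_le _ _ _ _ _ _ _ _

lemma pushL_le (x : LpSeq p X) : ‖S.pushL p r ν hν x‖ ≤ S.C * ‖x‖ := lpOp_le _ _ _ _ _ _ _ _

lemma coordL_pullL (x : LpSeq p X) (i k : ℕ) :
    S.coordL p i k (S.pullL p r hr ν hν x) = S.coordL p (r i) (ν i k) x := by
  rw [coordL_apply, pullL, lpOp_apply_of_mem _ _ _ _ _ _ _ _ (Set.mem_univ i), c_compressMap,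
    coordL_apply]

include hr in
lemma pushL_apply (x : LpSeq p X) (i : ℕ) :
    S.pushL p r ν hν x (r i) = S.spreadMap (ν i) (hν i) (x i) := by
  have key : ∀ j, j = i →
      S.spreadMap (ν j) (hν j) (x j) = S.spreadMap (ν i) (hν i) (x i) := by
    rintro _ rfl; rfl
  exact (lpOp_apply_of_mem _ _ _ _ _ _ _ _ (Set.mem_range_self i)).trans
    (key _ (Function.leftInverse_invFun hr i))

lemma pushL_apply_of_notMem (x : LpSeq p X) {m : ℕ} (hm : m ∉ Set.range r) :
    S.pushL p r ν hν x m = 0 :=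
  lpOp_apply_of_notMem _ _ _ _ _ _ _ _ hm

include hr in
lemma coordL_pushL (x : LpSeq p X) (i k : ℕ) :
    S.coordL p (r i) (ν i k) (S.pushL p r ν hν x) = S.coordL p i k x := by
  rw [coordL_apply, S.pushL_apply r hr, c_spreadMap, coordL_apply]

include hr in
lemma coordL_pushL_of_ne (x : LpSeq p X) {m l : ℕ} (h : ∀ i k, ¬ (r i = m ∧ ν i k = l)) :
    S.coordL p m l (S.pushL p r ν hν x) = 0 := by
  rw [coordL_apply]
  by_cases hm : m ∈ Set.range r
  · obtain ⟨i, rfl⟩ := hm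
    rw [S.pushL_apply r hr]
    refine S.c_spreadMap_of_notMem _ _ _ ?_
    rintro ⟨k, hk⟩
    exact h i k ⟨rfl, hk⟩
  · rw [S.pushL_apply_of_notMem r ν hν x hm, map_zero]

lemma pullL_pushL (x : LpSeq p X) : S.pullL p r hr ν hν (S.pushL p r ν hν x) = x :=
  S.ext_coordL fun i k => by rw [coordL_pullL, S.coordL_pushL r hr]

include hr in
lemma pushL_vecL (i k : ℕ) : S.pushL p r ν hν (S.vecL p i k) = S.vecL p (r i) (ν i k) := by
  refine S.ext_coordL fun m l => ?_
  by_cases h : ∃ i' k', r i' = m ∧ ν i' k' = l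
  · obtain ⟨i', k', rfl, rfl⟩ := h
    rw [S.coordL_pushL r hr, coordL_vecL, coordL_vecL]
    congr 1
    refine propext ⟨fun ⟨h1, h2⟩ => by rw [h1, h2]; exact ⟨rfl, rfl⟩, fun ⟨h1, h2⟩ => ?_⟩
    have h1 := hr h1
    subst h1
    exact ⟨rfl, (hν _).injective h2⟩
  · push Not at h
    rw [S.coordL_pushL_of_ne r hr ν hν _ fun i k hik => h i k hik.1 hik.2, coordL_vecL, if_neg]
    rintro ⟨rfl, rfl⟩
    exact h i k rfl rfl

end Reindex

/-! ### Perturbation of diagonal operators. -/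

section AlmostDiagonal

variable (p)

/-- The coordinates of `ℓ^p(X)` arranged in a single sequence. -/
def flatCoord (s : ℕ) : LpSeq p X →L[ℝ] ℝ := S.coordL p s.unpair.1 s.unpair.2

/-- The unit vectors of `ℓ^p(X)` arranged in a single sequence. -/
def flatVec (s : ℕ) : LpSeq p X := S.vecL p s.unpair.1 s.unpair.2

/-- The projection onto the coordinates after `s` in the single-sequence arrangement. -/
def flatTail (s : ℕ) : LpSeq p X →L[ℝ] LpSeq p X := S.projL p fun i => {k | s < Nat.pair i k}

variable {p}

lemma ext_flatCoord {x y : LpSeq p X} (h : ∀ s, S.flatCoord p s x = S.flatCoord p s y) : x = y :=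
  S.ext_coordL fun i k => by
    have := h (Nat.pair i k)
    rwa [flatCoord, Nat.unpair_pair] at this

lemma flatCoord_flatVec (s t : ℕ) : S.flatCoord p s (S.flatVec p t) = if s = t then 1 else 0 := by
  rw [flatCoord, flatVec, coordL_vecL]
  congr 1
  refine propext ⟨fun h => ?_, fun h => by rw [h]; exact ⟨rfl, rfl⟩⟩
  rw [← Nat.pair_unpair s, ← Nat.pair_unpair t, h.1, h.2]

lemma flatCoord_flatTail (s t : ℕ) (x : LpSeq p X) :
    S.flatCoord p t (S.flatTail p s x) = if s < t then S.flatCoord p t x else 0 := by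
  rw [flatCoord, flatTail, coordL_projL]
  by_cases h : s < t
  · rw [if_pos h, Set.indicator_of_mem (by simpa using h), Pi.one_apply, one_mul]
  · rw [if_neg h, Set.indicator_of_notMem (by simpa using h), zero_mul]

lemma abs_flatCoord_le (s : ℕ) (x : LpSeq p X) : |S.flatCoord p s x| ≤ S.C * ‖x‖ :=
  (S.norm_c _ _).trans (mul_le_mul_of_nonneg_left (norm_apply_le x _) S.C_pos.le)

lemma eq_sum_add_flatTail (s : ℕ) (x : LpSeq p X) :
    x = ∑ t ∈ Finset.range s, S.flatCoord p t x • S.flatVec p t + S.flatCoord p s x • S.flatVec p s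
      + S.flatTail p s x := by
  rw [← Finset.sum_range_succ (fun t => S.flatCoord p t x • S.flatVec p t) s]
  refine S.ext_flatCoord fun t => ?_
  rw [map_add, map_sum, flatCoord_flatTail]
  simp only [map_smul, flatCoord_flatVec, smul_eq_mul, mul_ite, mul_one, mul_zero]
  rw [Finset.sum_ite_eq]
  by_cases h : s < t
  · rw [if_neg (by simp; omega), if_pos h, zero_add]
  · rw [if_pos (by simp; omega), if_neg h, add_zero]

variable [CompleteSpace X]

/-- Below the diagonal the error is summed column by column, as tails of the images of unit vectors;
above it, coordinate by coordinate. The latter uses `A` on the whole tail of `x`, because that tail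
need not be a norm limit of combinations of unit vectors. Both series converge absolutely. -/
lemma norm_sub_diagonal_le (A : LpSeq p X →L[ℝ] LpSeq p X) {η : ℕ → ℝ} {ε : ℝ} (hη : HasSum η ε)
    (h1 : ∀ s x, |S.flatCoord p s (A (S.flatTail p s x))| ≤ η s * ‖x‖)
    (h2 : ∀ s, ‖S.flatTail p s (A (S.flatVec p s))‖ ≤ η s) {x y : LpSeq p X}
    (hy : ∀ s, S.flatCoord p s y = S.flatCoord p s (A (S.flatVec p s)) * S.flatCoord p s x) :
    ‖A x - y‖ ≤ (S.C + 1) * ε * ‖x‖ := by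
  set a : ℕ → LpSeq p X := fun s => S.flatCoord p s x • S.flatTail p s (A (S.flatVec p s)) with ha
  set b : ℕ → LpSeq p X := fun s => S.flatCoord p s (A (S.flatTail p s x)) • S.flatVec p s with hb
  have hale : ∀ s, ‖a s‖ ≤ η s * (S.C * ‖x‖) := fun s => by
    rw [ha, norm_smul, mul_comm]
    exact mul_le_mul (h2 s) (S.abs_flatCoord_le s x) (abs_nonneg _) ((norm_nonneg _).trans (h2 s))
  have hble : ∀ s, ‖b s‖ ≤ η s * ‖x‖ := fun s => by
    rw [hb, norm_smul, flatVec, norm_vecL, mul_one]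
    exact h1 s x
  have hasum := hη.mul_right (S.C * ‖x‖)
  have hbsum := hη.mul_right ‖x‖
  have has : Summable a := Summable.of_norm_bounded hasum.summable hale
  have hbs : Summable b := Summable.of_norm_bounded hbsum.summable hble
  have heq : A x - y = ∑' s, a s + ∑' s, b s := by
    refine S.ext_flatCoord fun s => ?_
    rw [map_sub, hy, map_add, ContinuousLinearMap.map_tsum _ has,
      ContinuousLinearMap.map_tsum _ hbs]
    have e1 : ∑' t, S.flatCoord p s (b t) = S.flatCoord p s (A (S.flatTail p s x)) := by
      rw [tsum_eq_single s fun t ht => by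
        simp only [hb, map_smul, flatCoord_flatVec, if_neg ht.symm, smul_zero]]
      simp [hb, flatCoord_flatVec]
    have e2 : ∑' t, S.flatCoord p s (a t)
        = ∑ t ∈ Finset.range s, S.flatCoord p t x * S.flatCoord p s (A (S.flatVec p t)) := by
      rw [tsum_eq_sum (s := Finset.range s) fun t ht => by
        simp only [ha, map_smul, flatCoord_flatTail, if_neg (mt Finset.mem_range.2 ht), smul_zero]]
      refine Finset.sum_congr rfl fun t ht => ?_
      simp only [ha, map_smul, flatCoord_flatTail, if_pos (Finset.mem_range.1 ht), smul_eq_mul]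
    rw [e1, e2]
    have e3 : S.flatCoord p s (A x)
        = ∑ t ∈ Finset.range s, S.flatCoord p t x * S.flatCoord p s (A (S.flatVec p t))
          + S.flatCoord p s x * S.flatCoord p s (A (S.flatVec p s))
          + S.flatCoord p s (A (S.flatTail p s x)) := by
      conv_lhs => rw [S.eq_sum_add_flatTail s x]
      simp only [map_add, map_sum, map_smul, smul_eq_mul]
    rw [e3]
    ring
  rw [heq]
  refine (norm_add_le _ _).trans ((add_le_add (tsum_of_norm_bounded hasum hale)
    (tsum_of_norm_bounded hbsum hble)).trans_eq (by ring))

end AlmostDiagonal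

end CoordSystem

/-! ### Factoring the identity through T or 1 - T. -/

namespace CoordSystem

variable {X : Type*} [NormedAddCommGroup X] [NormedSpace ℝ X] (S : CoordSystem X)
  {p : ℝ≥0∞} [hp : Fact (1 ≤ p)]

/-- Every operator on `ℓ^p(X)` is, on a suitable copy of `ℓ^p(X)`, close to a diagonal operator. -/
lemma exists_near_diagonal [CompleteSpace X] (T : LpSeq p X →L[ℝ] LpSeq p X) {ε : ℝ} (hε : 0 < ε) :
    ∃ (r : ℕ → ℕ) (hr : Function.Injective r) (ν : ℕ → ℕ → ℕ) (hν : ∀ i, StrictMono (ν i))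
      (d : ℕ → ℕ → ℝ), ∀ x y : LpSeq p X, (∀ i k, S.coordL p i k y = d i k * S.coordL p i k x) →
        ‖S.pullL p r hr ν hν (T (S.pushL p r ν hν x)) - y‖ ≤ ε * ‖x‖ := by
  have hC := S.C_pos
  -- The factor `S.C + 1` comes from `norm_sub_diagonal_le`; `S.C ^ 2` pays for a tail projection
  -- together with `pushL` or `pullL`.
  set ε' : ℝ := ε / ((S.C + 1) * S.C ^ 2) with hε'
  have hε'0 : 0 < ε' := by positivity
  obtain ⟨r, n, hr, hn, hR⟩ := S.exists_positions T (η := fun s => ε' / 2 / 2 ^ s)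
    fun s => by positivity
  have hν : ∀ i, StrictMono fun k => n (Nat.pair i k) := fun i =>
    hn.comp fun a b hab => Nat.pair_lt_pair_right i hab
  set ν : ℕ → ℕ → ℕ := fun i k => n (Nat.pair i k) with hνdef
  set A : LpSeq p X →L[ℝ] LpSeq p X := S.pullL p r hr ν hν ∘L T ∘L S.pushL p r ν hν with hA
  have hAapp : ∀ x, A x = S.pullL p r hr ν hν (T (S.pushL p r ν hν x)) := fun _ => rfl
  have hτ : ∀ s x, S.flatCoord p s (S.pullL p r hr ν hν x)
      = S.coordL p (r s.unpair.1) (n s) x := fun s x => by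
    rw [flatCoord, coordL_pullL]
    simp only [hνdef, Nat.pair_unpair]
  have hσ : ∀ s, S.pushL p r ν hν (S.flatVec p s) = S.vecL p (r s.unpair.1) (n s) := fun s => by
    rw [flatVec, S.pushL_vecL r hr]
    simp only [hνdef, Nat.pair_unpair]
  refine ⟨r, hr, ν, hν, fun i k => S.flatCoord p (Nat.pair i k) (A (S.flatVec p (Nat.pair i k))),
    fun x y hy => ?_⟩
  have hsum : HasSum (fun s : ℕ => S.C ^ 2 * (ε' / 2 / 2 ^ s)) (S.C ^ 2 * ε') :=
    (hasSum_geometric_two' ε').mul_left _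
  refine (S.norm_sub_diagonal_le A hsum (fun s x => ?_) (fun s => ?_) (x := x) (y := y)
    fun s => ?_).trans_eq ?_
  · obtain ⟨R, h1, h2, -⟩ := hR s
    -- All positions selected after `s` lie in `R`, so the image of a tail under `pushL` is already
    -- supported there.
    have hproj : S.projL p R (S.pushL p r ν hν (S.flatTail p s x))
        = S.pushL p r ν hν (S.flatTail p s x) := by
      refine S.ext_coordL fun m l => ?_
      rw [coordL_projL]
      by_cases h : ∃ i k, r i = m ∧ ν i k = l
      · obtain ⟨i, k, rfl, rfl⟩ := h
        rw [S.coordL_pushL r hr, flatTail, coordL_projL]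
        by_cases hs : s < Nat.pair i k
        · have := h1 _ hs
          rw [Nat.unpair_pair] at this
          rw [Set.indicator_of_mem this, Pi.one_apply, one_mul]
        · rw [Set.indicator_of_notMem (s := {k | s < Nat.pair i k}) hs]
          ring
      · push Not at h
        rw [S.coordL_pushL_of_ne r hr ν hν _ fun i k hik => h i k hik.1 hik.2, mul_zero]
    rw [hAapp, hτ, ← hproj]
    refine (h2 _).trans ?_
    rw [mul_comm (S.C ^ 2), mul_assoc]
    refine mul_le_mul_of_nonneg_left ((S.pushL_le r ν hν _).trans ?_) (by positivity)
    rw [pow_two, mul_assoc]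
    exact mul_le_mul_of_nonneg_left (S.projL_le _ _) hC.le
  · obtain ⟨R, h1, -, h3⟩ := hR s
    have hproj : S.flatTail p s (S.pullL p r hr ν hν (T (S.vecL p (r s.unpair.1) (n s))))
        = S.flatTail p s (S.pullL p r hr ν hν
          (S.projL p R (T (S.vecL p (r s.unpair.1) (n s))))) := by
      refine S.ext_flatCoord fun t => ?_
      rw [flatCoord_flatTail, flatCoord_flatTail, hτ, hτ, coordL_projL]
      split_ifs with hs
      · rw [Set.indicator_of_mem (h1 t hs), Pi.one_apply, one_mul]
      · rfl
    rw [hAapp, hσ, hproj]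
    refine (S.projL_le _ _).trans ?_
    rw [pow_two, mul_assoc]
    refine mul_le_mul_of_nonneg_left ((S.pullL_le r hr ν hν _).trans ?_) hC.le
    exact mul_le_mul_of_nonneg_left h3 hC.le
  · have := hy s.unpair.1 s.unpair.2
    beta_reduce at this
    rwa [Nat.pair_unpair] at this
  · rw [hε']
    field_simp

variable (p) in
/-- The diagonal operator with bounded symbol `d`. -/
def diagL (d : ℕ → ℕ → ℝ) (M : ℝ) (hM : 0 ≤ M) (h : ∀ i k, |d i k| ≤ M) :
    LpSeq p X →L[ℝ] LpSeq p X :=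
  lpOp p Set.univ id (Set.injOn_id _) (fun i => S.diag (d i) M (h i)) (S.C * M)
    (mul_nonneg S.C_pos.le hM) fun i x => S.diag_le (d i) M (h i) x

lemma coordL_diagL (d : ℕ → ℕ → ℝ) (M : ℝ) (hM : 0 ≤ M) (h : ∀ i k, |d i k| ≤ M) (x : LpSeq p X)
    (i k : ℕ) : S.coordL p i k (S.diagL p d M hM h x) = d i k * S.coordL p i k x := by
  have : S.diagL p d M hM h x i = S.diag (d i) M (h i) (x i) :=
    lpOp_apply_of_mem _ _ _ _ _ _ _ _ (Set.mem_univ i)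
  rw [coordL_apply, this, c_diag, coordL_apply]

lemma diagL_le (d : ℕ → ℕ → ℝ) (M : ℝ) (hM : 0 ≤ M) (h : ∀ i k, |d i k| ≤ M) (x : LpSeq p X) :
    ‖S.diagL p d M hM h x‖ ≤ S.C * M * ‖x‖ := lpOp_le _ _ _ _ _ _ _ _

lemma exists_strictMono_of_infinite {s : Set ℕ} (hs : s.Infinite) :
    ∃ φ : ℕ → ℕ, StrictMono φ ∧ ∀ n, φ n ∈ s :=
  extraction_of_frequently_atTop (Nat.frequently_atTop_iff_infinite.2 hs)

/-- The identity factors through an operator that is close to a bounded diagonal operator with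
infinitely many rows having infinitely many entries bounded away from zero. -/
lemma exists_factor_of_near_diagonal [CompleteSpace X] (A : LpSeq p X →L[ℝ] LpSeq p X)
    (d : ℕ → ℕ → ℝ) {K : ℝ} (hd : ∀ i k, |d i k| ≤ K) {ε : ℝ} (hε : 4 * S.C ^ 3 * ε ≤ 1)
    (hA : ∀ x y : LpSeq p X, (∀ i k, S.coordL p i k y = d i k * S.coordL p i k x) →
      ‖A x - y‖ ≤ ε * ‖x‖)
    (hinf : {i | {k | 1 / 2 ≤ |d i k|}.Infinite}.Infinite) :
    ∃ U V : LpSeq p X →L[ℝ] LpSeq p X, ∀ x, U (A (V x)) = x := by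
  have hC := S.C_pos
  have hK : 0 ≤ K := (abs_nonneg _).trans (hd 0 0)
  obtain ⟨r, hr, hr'⟩ := exists_strictMono_of_infinite hinf
  choose ν hν hν' using fun i => exists_strictMono_of_infinite (hr' i)
  have hbd : ∀ i k, |(d (r i) (ν i k))⁻¹| ≤ 2 := fun i k => by
    rw [abs_inv]
    have h12 : (1 / 2 : ℝ) ≤ |d (r i) (ν i k)| := hν' i k
    calc |d (r i) (ν i k)|⁻¹ ≤ (1 / 2 : ℝ)⁻¹ := inv_anti₀ (by norm_num) h12
      _ = 2 := by norm_num
  set W := S.diagL p (fun i k => (d (r i) (ν i k))⁻¹) 2 zero_le_two hbd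
  set P := S.pullL p r hr.injective ν hν
  set J := S.pushL p r ν hν
  set D := S.diagL p d K hK hd
  have hWD : ∀ x, W (P (D (J x))) = x := fun x => by
    refine S.ext_coordL fun i k => ?_
    rw [coordL_diagL, coordL_pullL, coordL_diagL, S.coordL_pushL r hr.injective, inv_mul_cancel_left₀]
    intro h0
    have h12 : (1 / 2 : ℝ) ≤ |d (r i) (ν i k)| := hν' i k
    rw [h0, abs_zero] at h12
    norm_num at h12
  set Bop : LpSeq p X →L[ℝ] LpSeq p X := W ∘L P ∘L A ∘L J with hB
  -- `W`, `P` and `J` contribute `2 * S.C`, `S.C` and `S.C`, so the error is at most `2 * S.C ^ 3 *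
  -- ε ≤ 1 / 2`.
  have hsmall : ‖1 - Bop‖ < 1 := by
    refine lt_of_le_of_lt (ContinuousLinearMap.opNorm_le_bound _ (M := 1 / 2) (by norm_num)
      fun x => ?_) (by norm_num)
    have e : (1 - Bop) x = -(W (P (A (J x) - D (J x)))) := by
      rw [map_sub, map_sub, hWD]
      change x - W (P (A (J x))) = _
      abel
    rw [e, norm_neg]
    refine (S.diagL_le _ _ _ _ _).trans ?_
    calc S.C * 2 * ‖P (A (J x) - D (J x))‖
        ≤ S.C * 2 * (S.C * (ε * ‖J x‖)) := by
          refine mul_le_mul_of_nonneg_left ((S.pullL_le _ _ _ _ _).trans ?_) (by positivity)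
          exact mul_le_mul_of_nonneg_left (hA _ _ fun i k => S.coordL_diagL _ _ _ _ _ _ _) hC.le
      _ = 2 * S.C ^ 2 * (ε * ‖J x‖) := by ring
      _ ≤ 2 * S.C ^ 2 * (1 / (4 * S.C ^ 3) * (S.C * ‖x‖)) := by
          refine mul_le_mul_of_nonneg_left ?_ (by positivity)
          refine mul_le_mul ?_ (S.pushL_le _ _ _ _) (norm_nonneg _) (by positivity)
          rw [le_div_iff₀ (by positivity)]
          linarith
      _ = 1 / 2 * ‖x‖ := by field_simp; norm_num
  have hu : IsUnit Bop := by
    have := isUnit_one_sub_of_norm_lt_one hsmall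
    rwa [sub_sub_cancel] at this
  obtain ⟨u, hu⟩ := hu
  refine ⟨(↑u⁻¹ : LpSeq p X →L[ℝ] LpSeq p X) ∘L W ∘L P, J, fun x => ?_⟩
  have h1 : (↑u⁻¹ * ↑u : LpSeq p X →L[ℝ] LpSeq p X) x = x := by
    rw [Units.inv_mul]; rfl
  rw [hu] at h1
  exact h1

include S in
/-- The identity of `ℓ^p(X)` factors through `T` or through `1 - T`. -/
theorem exists_factor [CompleteSpace X] (T : LpSeq p X →L[ℝ] LpSeq p X) :
    (∃ U V : LpSeq p X →L[ℝ] LpSeq p X, ∀ x, U (T (V x)) = x) ∨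
      ∃ U V : LpSeq p X →L[ℝ] LpSeq p X, ∀ x, U ((1 - T) (V x)) = x := by
  have hC := S.C_pos
  obtain ⟨r, hr, ν, hν, d, hd⟩ := S.exists_near_diagonal T (ε := 1 / (4 * S.C ^ 3)) (by positivity)
  have hε : 4 * S.C ^ 3 * (1 / (4 * S.C ^ 3)) ≤ 1 := by
    rw [mul_one_div_cancel (by positivity)]
  set P := S.pullL p r hr ν hν
  set J := S.pushL p r ν hν
  set K : ℝ := S.C * (1 / (4 * S.C ^ 3) + S.C * (‖T‖ * S.C)) with hK
  have hK0 : 0 ≤ K := by positivity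
  -- Near-diagonality tested on unit vectors bounds the diagonal entries, which were not known to be
  -- bounded before.
  have hdK : ∀ i k, |d i k| ≤ K := by
    intro i k
    set v := S.vecL p i k
    have h1 := hd v (d i k • v) fun i' k' => by
      rw [map_smul, smul_eq_mul, coordL_vecL]
      split_ifs with h
      · rw [h.1, h.2]
      · ring
    have h2 : ‖v‖ = 1 := S.norm_vecL i k
    have h3 : ‖P (T (J v))‖ ≤ S.C * (‖T‖ * S.C) := by
      refine (S.pullL_le _ _ _ _ _).trans (mul_le_mul_of_nonneg_left ?_ hC.le)
      refine (T.le_opNorm _).trans (mul_le_mul_of_nonneg_left ?_ (norm_nonneg _))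
      simpa [h2] using S.pushL_le (p := p) r ν hν v
    have h4 : |d i k| = ‖d i k • v‖ := by rw [norm_smul, h2, mul_one, Real.norm_eq_abs]
    have h5 := norm_sub_norm_le (d i k • v) (P (T (J v)))
    rw [norm_sub_rev] at h5
    rw [h2, mul_one] at h1
    have h6 : |d i k| ≤ 1 / (4 * S.C ^ 3) + S.C * (‖T‖ * S.C) := by
      rw [h4]; linarith
    exact h6.trans (le_mul_of_one_le_left (by positivity) S.one_le)
  have hcover : ∀ i, {k | 1 / 2 ≤ |d i k|}.Infinite ∨ {k | 1 / 2 ≤ |1 - d i k|}.Infinite := by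
    intro i
    rw [← Set.infinite_union]
    refine Set.infinite_univ.mono fun k _ => ?_
    by_contra h
    rw [Set.mem_union, not_or] at h
    have h1 : |d i k| < 1 / 2 := not_le.1 h.1
    have h2 : |1 - d i k| < 1 / 2 := not_le.1 h.2
    have := abs_add_le (d i k) (1 - d i k)
    rw [add_sub_cancel, abs_one] at this
    linarith
  have hcover' : {i | {k | 1 / 2 ≤ |d i k|}.Infinite}.Infinite ∨
      {i | {k | 1 / 2 ≤ |1 - d i k|}.Infinite}.Infinite := by
    rw [← Set.infinite_union]
    exact Set.infinite_univ.mono fun i _ => hcover i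
  rcases hcover' with h | h
  · left
    obtain ⟨U, V, hUV⟩ := S.exists_factor_of_near_diagonal (P ∘L T ∘L J) d hdK hε hd h
    exact ⟨U ∘L P, J ∘L V, hUV⟩
  · right
    -- Since `P` is a left inverse of `J`, compressing `1 - T` gives the identity minus the
    -- compression of `T`, with diagonal `1 - d` and the same error.
    obtain ⟨U, V, hUV⟩ := S.exists_factor_of_near_diagonal (P ∘L (1 - T) ∘L J)
      (fun i k => 1 - d i k) (K := 1 + K) (fun i k => (abs_sub _ _).trans (by
        rw [abs_one]; exact add_le_add_right (hdK i k) 1)) hε (fun x y hy => by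
          have h1 := hd x (x - y) fun i k => by rw [map_sub, hy]; ring
          have e : (P ∘L (1 - T) ∘L J) x - y = -(P (T (J x)) - (x - y)) := by
            change P (J x - T (J x)) - y = _
            rw [map_sub, S.pullL_pushL]
            abel
          rw [e, norm_neg]
          exact h1) h
    exact ⟨U ∘L P, J ∘L V, hUV⟩

end CoordSystem

/-! ### Pełczyński's decomposition method. -/

section Decomposition

variable {X E : Type*} [NormedAddCommGroup X] [NormedSpace ℝ X] [NormedAddCommGroup E]
  [NormedSpace ℝ E] (p : ℝ≥0∞) [hp : Fact (1 ≤ p)]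

/-- The right shift. -/
def shiftRight : LpSeq p E →L[ℝ] LpSeq p E :=
  lpOp p {i | i ≠ 0} Nat.pred (fun a ha b hb hab => Nat.pred_inj (Nat.pos_of_ne_zero ha)
    (Nat.pos_of_ne_zero hb) hab) (fun _ => 1) 1 zero_le_one fun i x => by simp

/-- The left shift. -/
def shiftLeft : LpSeq p E →L[ℝ] LpSeq p E :=
  lpOp p Set.univ Nat.succ Nat.succ_injective.injOn (fun _ => 1) 1 zero_le_one fun i x => by simp

/-- The coordinatewise application of an operator. -/
def mapL (Q : E →L[ℝ] E) : LpSeq p E →L[ℝ] LpSeq p E :=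
  lpOp p Set.univ id (Set.injOn_id _) (fun _ => Q) ‖Q‖ (norm_nonneg Q) fun _ x => Q.le_opNorm x

variable {p}

lemma shiftRight_zero (x : LpSeq p E) : shiftRight p x 0 = 0 :=
  lpOp_apply_of_notMem _ _ _ _ _ _ _ _ (by simp)

lemma shiftRight_succ (x : LpSeq p E) (i : ℕ) : shiftRight p x (i + 1) = x i :=
  lpOp_apply_of_mem _ _ _ _ _ _ _ _ (by simp)

lemma shiftLeft_apply (x : LpSeq p E) (i : ℕ) : shiftLeft p x i = x (i + 1) :=
  lpOp_apply_of_mem _ _ _ _ _ _ _ _ (Set.mem_univ i)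

lemma mapL_apply (Q : E →L[ℝ] E) (x : LpSeq p E) (i : ℕ) : mapL p Q x i = Q (x i) :=
  lpOp_apply_of_mem _ _ _ _ _ _ _ _ (Set.mem_univ i)

/-- The range of a projection on `E` is absorbed by `ℓ^p(E)`. -/
def rangeProdEquiv (Q : E →L[ℝ] E) (hQ : IsIdempotentElem Q) :
    (Q.range × LpSeq p E) ≃L[ℝ] LpSeq p E :=
  have hQQ : ∀ x, Q (Q x) = Q x := fun x => DFunLike.congr_fun hQ x
  have hQr : ∀ z : Q.range, Q z = z := by
    rintro ⟨_, x, rfl⟩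
    exact hQQ x
  ContinuousLinearEquiv.equivOfInverse
    -- The `Q`-parts of all entries move one place to the right, `z` fills the freed `Q`-part of
    -- entry 0, and the complementary parts stay put. The inverse shifts the `Q`-parts back.
    ((lp.singleContinuousLinearMap ℝ (fun _ : ℕ => E) p 0 ∘L Q.range.subtypeL).coprod
      (shiftRight p ∘L mapL p Q + (1 - mapL p Q)))
    ((((Q.codRestrict Q.range fun x => ⟨x, rfl⟩) ∘L lp.evalCLM ℝ (fun _ : ℕ => E) p 0)).prod
      (shiftLeft p ∘L mapL p Q + (1 - mapL p Q)))
    (by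
      rintro ⟨z, x⟩
      set w := ((lp.singleContinuousLinearMap ℝ (fun _ : ℕ => E) p 0 ∘L Q.range.subtypeL).coprod
        (shiftRight p ∘L mapL p Q + (1 - mapL p Q))) (z, x) with hw
      have h0 : w 0 = z + (x 0 - Q (x 0)) := by
        change (lp.single p 0 (z : E) : LpSeq p E) 0
          + (shiftRight p (mapL p Q x) 0 + (x 0 - mapL p Q x 0)) = _
        rw [lp.single_apply_self, shiftRight_zero, mapL_apply, zero_add]
      have h1 : ∀ i, w (i + 1) = Q (x i) + (x (i + 1) - Q (x (i + 1))) := fun i => by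
        change (lp.single p 0 (z : E) : LpSeq p E) (i + 1)
          + (shiftRight p (mapL p Q x) (i + 1) + (x (i + 1) - mapL p Q x (i + 1))) = _
        rw [lp.single_apply_ne _ _ _ (Nat.succ_ne_zero i), shiftRight_succ, mapL_apply, mapL_apply,
          zero_add]
      refine Prod.ext (Subtype.ext ?_) (lp.ext (funext fun i => ?_))
      · change Q (w 0) = z
        rw [h0, map_add, map_sub, hQQ, sub_self, add_zero, hQr]
      · change shiftLeft p (mapL p Q w) i + (w i - mapL p Q w i) = x i
        rw [shiftLeft_apply, mapL_apply, mapL_apply, h1]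
        cases i with
        | zero => rw [h0]; simp only [map_add, map_sub, hQQ, hQr]; abel
        | succ i => rw [h1]; simp only [map_add, map_sub, hQQ]; abel)
    (by
      intro w
      set x := (shiftLeft p ∘L mapL p Q + (1 - mapL p Q)) w with hx
      have hxi : ∀ i, x i = Q (w (i + 1)) + (w i - Q (w i)) := fun i => by
        change shiftLeft p (mapL p Q w) i + (w i - mapL p Q w i) = _
        rw [shiftLeft_apply, mapL_apply, mapL_apply]
      refine lp.ext (funext fun i => ?_)
      change (lp.single p 0 (Q (w 0)) : LpSeq p E) i
        + (shiftRight p (mapL p Q x) i + (x i - mapL p Q x i)) = w i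
      cases i with
      | zero =>
        rw [lp.single_apply_self, shiftRight_zero, mapL_apply, hxi]
        simp only [map_add, map_sub, hQQ]; abel
      | succ i =>
        rw [lp.single_apply_ne _ _ _ (Nat.succ_ne_zero i), shiftRight_succ, mapL_apply, mapL_apply,
          hxi, hxi]
        simp only [map_add, map_sub, hQQ]; abel)

end Decomposition

section Curry

variable {X E : Type*} [NormedAddCommGroup X] [NormedSpace ℝ X] [NormedAddCommGroup E]
  [NormedSpace ℝ E] {p : ℝ≥0∞} [hp : Fact (1 ≤ p)]

variable (p X) in
/-- The block `k ↦ x (pair i k)` of a sequence. -/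
def block (i : ℕ) : LpSeq p X →L[ℝ] LpSeq p X :=
  lpOp p Set.univ (Nat.pair i) (fun _ _ _ _ h => (Nat.pair_eq_pair.1 h).2) (fun _ => 1) 1 zero_le_one
    fun i x => by simp

lemma block_apply (i k : ℕ) (x : LpSeq p X) : block X p i x k = x (Nat.pair i k) :=
  lpOp_apply_of_mem _ _ _ _ _ _ _ _ (Set.mem_univ k)

lemma block_le (i : ℕ) (x : LpSeq p X) : ‖block X p i x‖ ≤ ‖x‖ :=
  (lpOp_le _ _ _ _ _ _ _ _).trans_eq (one_mul _)

lemma memℓp_block (x : LpSeq p X) : ∃ h : Memℓp (fun i => block X p i x) p,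
    ‖(⟨_, h⟩ : LpSeq p (LpSeq p X))‖ ≤ 1 * ‖x‖ := by
  have hp0 : p ≠ 0 := (zero_lt_one.trans_le hp.out).ne'
  rw [one_mul]
  rcases eq_or_ne p ∞ with rfl | hpt
  · exact ⟨memℓp_infty ⟨‖x‖, by rintro _ ⟨i, rfl⟩; exact block_le i x⟩,
      lp.norm_le_of_forall_le (norm_nonneg x) fun i => block_le i x⟩
  · have hpp : 0 < p.toReal := ENNReal.toReal_pos hp0 hpt
    have hs : HasSum (fun i => ‖block X p i x‖ ^ p.toReal) (‖x‖ ^ p.toReal) := by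
      refine (Nat.pairEquiv.hasSum_iff.2 (lp.hasSum_norm hpp x)).prod_fiberwise fun i => ?_
      refine (lp.hasSum_norm hpp (block X p i x)).congr_fun ?_
      intro k
      rw [block_apply]
      rfl
    exact ⟨memℓp_gen hs.summable, lp.norm_le_of_tsum_le hpp (norm_nonneg x) hs.tsum_eq.le⟩

omit [NormedSpace ℝ X] in
lemma memℓp_unblock (y : LpSeq p (LpSeq p X)) :
    ∃ h : Memℓp (fun s : ℕ => y s.unpair.1 s.unpair.2) p,
      ‖(⟨_, h⟩ : LpSeq p X)‖ ≤ 1 * ‖y‖ := by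
  have hp0 : p ≠ 0 := (zero_lt_one.trans_le hp.out).ne'
  rw [one_mul]
  have hy0 := norm_nonneg y
  rcases eq_or_ne p ∞ with rfl | hpt
  · have hb : ∀ s : ℕ, ‖y s.unpair.1 s.unpair.2‖ ≤ ‖y‖ := fun s =>
      (lp.norm_apply_le_norm hp0 _ _).trans (lp.norm_apply_le_norm hp0 _ _)
    exact ⟨memℓp_infty ⟨‖y‖, by rintro _ ⟨i, rfl⟩; exact hb i⟩, lp.norm_le_of_forall_le hy0 hb⟩
  · have hpp : 0 < p.toReal := ENNReal.toReal_pos hp0 hpt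
    have hb : ∀ t : Finset ℕ, ∑ s ∈ t, ‖y s.unpair.1 s.unpair.2‖ ^ p.toReal ≤ ‖y‖ ^ p.toReal := by
      intro t
      set u : Finset (ℕ × ℕ) := t.map Nat.pairEquiv.symm.toEmbedding
      calc ∑ s ∈ t, ‖y s.unpair.1 s.unpair.2‖ ^ p.toReal
          = ∑ q ∈ u, ‖y q.1 q.2‖ ^ p.toReal := by
            rw [Finset.sum_map]
            rfl
        _ ≤ ∑ q ∈ u.image Prod.fst ×ˢ u.image Prod.snd, ‖y q.1 q.2‖ ^ p.toReal :=
            Finset.sum_le_sum_of_subset_of_nonneg Finset.subset_product fun _ _ _ => by positivity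
        _ = ∑ i ∈ u.image Prod.fst, ∑ k ∈ u.image Prod.snd, ‖y i k‖ ^ p.toReal :=
            Finset.sum_product _ _ _
        _ ≤ ∑ i ∈ u.image Prod.fst, ‖y i‖ ^ p.toReal :=
            Finset.sum_le_sum fun i _ => lp.sum_rpow_le_norm_rpow hpp (y i) _
        _ ≤ ‖y‖ ^ p.toReal := lp.sum_rpow_le_norm_rpow hpp y _
    exact ⟨memℓp_gen' hb, lp.norm_le_of_forall_sum_le hpp hy0 hb⟩

variable (p X) in
/-- The isomorphism between `ℓ^p(X)` and `ℓ^p(ℓ^p(X))`. -/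
def curryEquiv : LpSeq p X ≃L[ℝ] LpSeq p (LpSeq p X) :=
  ContinuousLinearEquiv.equivOfInverse
    (LinearMap.mkContinuous
      { toFun := fun x => (⟨_, (memℓp_block x).1⟩ : LpSeq p (LpSeq p X))
        map_add' := fun x y => lp.ext (funext fun i => map_add (block X p i) x y)
        map_smul' := fun a x => lp.ext (funext fun i => map_smul (block X p i) a x) } 1
      fun x => (memℓp_block x).2)
    (LinearMap.mkContinuous
      { toFun := fun y => (⟨_, (memℓp_unblock y).1⟩ : LpSeq p X)
        map_add' := fun _ _ => rfl
        map_smul' := fun _ _ => rfl } 1 fun y => (memℓp_unblock y).2)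
    (fun x => lp.ext (funext fun s => by
      change block X p s.unpair.1 x s.unpair.2 = x s
      rw [block_apply, Nat.pair_unpair]))
    (fun y => lp.ext (funext fun i => lp.ext (funext fun k => by
      refine (block_apply i k _).trans ?_
      change y (Nat.pair i k).unpair.1 (Nat.pair i k).unpair.2 = y i k
      rw [Nat.unpair_pair])))

/-- The range of the identity is the whole space. -/
def rangeOneEquiv : (1 : E →L[ℝ] E).range ≃L[ℝ] E :=
  ContinuousLinearEquiv.equivOfInverse (1 : E →L[ℝ] E).range.subtypeL
    ((1 : E →L[ℝ] E).codRestrict _ fun x => ⟨x, rfl⟩) (fun _ => rfl) fun _ => rfl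

/-- **Pełczyński's decomposition method**: if the identity of `ℓ^p(X)` factors through a
projection, then the range of the projection is isomorphic to `ℓ^p(X)`. -/
theorem nonempty_range_equiv_of_factor (Q : LpSeq p X →L[ℝ] LpSeq p X) (hQ : IsIdempotentElem Q)
    (U V : LpSeq p X →L[ℝ] LpSeq p X) (hUV : ∀ x, U (Q (V x)) = x) :
    Nonempty (Q.range ≃L[ℝ] LpSeq p X) := by
  have absorb : ∀ P : LpSeq p X →L[ℝ] LpSeq p X, IsIdempotentElem P →
      Nonempty ((P.range × LpSeq p X) ≃L[ℝ] LpSeq p X) := fun P hP =>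
    ⟨((ContinuousLinearEquiv.refl ℝ P.range).prodCongr (curryEquiv X p)).trans
      ((rangeProdEquiv P hP).trans (curryEquiv X p).symm)⟩
  obtain ⟨e₁⟩ := absorb Q hQ
  obtain ⟨e₂⟩ := absorb 1 (one_mul 1)
  have e₃ : (LpSeq p X × LpSeq p X) ≃L[ℝ] LpSeq p X :=
    (rangeOneEquiv.symm.prodCongr (ContinuousLinearEquiv.refl ℝ _)).trans e₂
  let f₁ : Q.range →L[ℝ] LpSeq p X := U ∘L Q.range.subtypeL
  let f₂ : LpSeq p X →L[ℝ] Q.range := (Q ∘L V).codRestrict Q.range fun x => ⟨V x, rfl⟩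
  have e₄ : Q.range ≃L[ℝ] LpSeq p X × f₁.ker :=
    ContinuousLinearEquiv.equivOfRightInverse f₁ f₂ hUV
  -- With R the range of `Q` and N the kernel of `f₁`: R ≅ E × N ≅ (E × E) × N ≅ E × (E × N) ≅ E × R
  -- ≅ R × E ≅ E.
  exact ⟨e₄.trans ((e₃.symm.prodCongr (ContinuousLinearEquiv.refl ℝ _)).trans
    ((ContinuousLinearEquiv.prodAssoc ℝ _ _ _).trans
      (((ContinuousLinearEquiv.refl ℝ _).prodCongr e₄.symm).trans
        ((ContinuousLinearEquiv.prodComm ℝ _ _).trans e₁))))⟩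

theorem CoordSystem.isPrimarySpace [CompleteSpace X] (S : CoordSystem X) :
    IsPrimarySpace (LpSeq p X) := by
  intro Q hQ
  rcases S.exists_factor Q with ⟨U, V, h⟩ | ⟨U, V, h⟩
  · exact Or.inl (nonempty_range_equiv_of_factor Q hQ U V h)
  · exact Or.inr (nonempty_range_equiv_of_factor (1 - Q) hQ.one_sub U V h)

end Curry

/-! ### Constructing a coordinate system from the dual pairing. -/

section DualPairing

variable {X Y : Type*} [NormedAddCommGroup X] [NormedSpace ℝ X]
  [NormedAddCommGroup Y] [NormedSpace ℝ Y] {B : X →ₗ[ℝ] Y →ₗ[ℝ] ℝ} {e : ℕ → X} {f : ℕ → Y}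

lemma ext_of_coords (hB : IsDualPair B) (hb : IsBiorthogonalBasis B e f) {x y : X}
    (h : ∀ j, B x (f j) = B y (f j)) : x = y := by
  have h1 := hb.expansion x
  rw [funext h] at h1
  exact h1.eq hB (hb.expansion y)

lemma exists_mul {C : ℝ} (hb : IsBiorthogonalBasis B e f) (hu : IsUnconditionalWith B e C)
    (hC : 0 ≤ C) (γ : ℕ → ℝ) (M : ℝ) (hM : ∀ k, |γ k| ≤ M) (x : X) :
    ∃ z, (∀ j, B z (f j) = γ j * B x (f j)) ∧ ‖z‖ ≤ C * M * ‖x‖ := by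
  obtain ⟨z, hz, hn⟩ := hu (fun j => B x (f j)) γ x ⟨M, by rintro _ ⟨k, rfl⟩; exact hM k⟩
    (hb.expansion x)
  refine ⟨z, fun j => (congrFun (hb.unique z _ hz) j).symm, hn.trans ?_⟩
  gcongr
  exact ciSup_le hM

lemma one_le_of_unconditional {C : ℝ} (hB : IsDualPair B) (hb : IsBiorthogonalBasis B e f)
    (hu : IsUnconditionalWith B e C) : 1 ≤ C := by
  obtain ⟨z, hz, hn⟩ := hu (fun j => B (e 0) (f j)) (fun _ => 1) (e 0)
    ⟨1, by rintro _ ⟨k, rfl⟩; simp⟩ (hb.expansion (e 0))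
  simp only [one_mul] at hz
  rw [hz.eq hB (hb.expansion (e 0))] at hn
  simpa [hb.norm_left] using hn

lemma apply_coordProj {C : ℝ} (hb : IsBiorthogonalBasis B e f) (hu : IsUnconditionalWith B e C)
    (Λ : Set ℕ) (x : X) (j : ℕ) :
    B (coordProj B e f Λ x) (f j) = Λ.indicator (fun j => B x (f j)) j :=
  (congrFun (hb.unique _ _ (weakSum_coordProj hb hu Λ x)) j).symm

/-- Spreading supplies the limit `z`. Its coordinates are found by testing the weak convergence
against `f j`, where the partial sums are eventually constant. -/
lemma exists_spread {C : ℝ} (hB : IsDualPair B) (hb : IsBiorthogonalBasis B e f)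
    (hs : IsSpreadingWith B e C) (hC : 0 < C) (n : ℕ → ℕ) (hn : StrictMono n) (x : X) :
    ∃ z, (∀ j, B z (f j) = (Set.range n).indicator 1 j * B x (f (Function.invFun n j))) ∧
      ‖z‖ ≤ C * ‖x‖ := by
  obtain ⟨h1, h2⟩ := hs (fun j => B x (f j)) n hn
  obtain ⟨z, hz⟩ := h1.1 ⟨x, hb.expansion x⟩
  have h3 := (h2 x z (hb.expansion x) hz).1
  refine ⟨z, fun j => ?_, by rwa [one_div, inv_mul_le_iff₀ hC] at h3⟩
  refine tendsto_nhds_unique ((weakSum_iff hB).1 hz (f j)) ?_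
  by_cases hj : j ∈ Set.range n
  · obtain ⟨i, rfl⟩ := hj
    rw [Function.leftInverse_invFun hn.injective i, Set.indicator_of_mem (Set.mem_range_self i),
      Pi.one_apply, one_mul]
    refine tendsto_const_nhds.congr' ?_
    filter_upwards [eventually_gt_atTop i] with N hN
    rw [Finset.sum_eq_single_of_mem i (Finset.mem_range.2 hN) fun k _ hk => by
      rw [hb.pair_ne _ _ (hn.injective.ne hk), mul_zero], hb.pair_self, mul_one]
  · rw [Set.indicator_of_notMem hj, zero_mul]
    refine tendsto_const_nhds.congr fun N => (Finset.sum_eq_zero fun k _ => ?_).symm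
    rw [hb.pair_ne _ _ fun h => hj ⟨k, h⟩, mul_zero]

/-- The projection of `x` onto the range of `n` is a weak series along `e (n j)`, which spreading
carries back to `e j`. One factor `C` comes from the projection and one from spreading. -/
lemma exists_compress {C : ℝ} (hB : IsDualPair B) (hb : IsBiorthogonalBasis B e f)
    (hu : IsUnconditionalWith B e C) (hs : IsSpreadingWith B e C) (hC : 0 ≤ C) (n : ℕ → ℕ)
    (hn : StrictMono n) (x : X) :
    ∃ z, (∀ j, B z (f j) = B x (f (n j))) ∧ ‖z‖ ≤ C ^ 2 * ‖x‖ := by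
  obtain ⟨h1, h2⟩ := hs (fun j => B x (f (n j))) n hn
  have hw : WeakSum B (fun j => e (n j)) (fun j => B x (f (n j)))
      (coordProj B e f (Set.range n) x) := by
    rw [weakSum_iff hB]
    intro y
    refine (((weakSum_iff hB).1 (weakSum_coordProj hb hu (Set.range n) x) y).comp
      hn.tendsto_atTop).congr fun N => ?_
    rw [Function.comp_apply, ← Finset.sum_image
      (f := fun k => (Set.range n).indicator (fun j => B x (f j)) k * B (e k) y)
      (s := Finset.range N) (g := n) (fun a _ b _ h => hn.injective h) |>.trans
      (Finset.sum_congr rfl fun j _ => by rw [Set.indicator_of_mem (Set.mem_range_self j)])]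
    refine (Finset.sum_subset ?_ fun k hk hk' => ?_).symm
    · intro k hk
      obtain ⟨j, hj, rfl⟩ := Finset.mem_image.1 hk
      exact Finset.mem_range.2 (hn (Finset.mem_range.1 hj))
    · rw [Set.indicator_of_notMem, zero_mul]
      rintro ⟨j, rfl⟩
      exact hk' (Finset.mem_image_of_mem n
        (Finset.mem_range.2 (hn.lt_iff_lt.1 (Finset.mem_range.1 hk))))
  obtain ⟨z, hz⟩ := h1.2 ⟨_, hw⟩
  refine ⟨z, fun j => (congrFun (hb.unique z _ hz) j).symm, ?_⟩
  refine (h2 z _ hz hw).2.trans ?_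
  rw [pow_two, mul_assoc]
  have := norm_coordProj_le hB hb hu (Set.range n) x
  rw [abs_of_nonneg hC] at this
  gcongr

/-- Non-`ℓ¹`-splicing systems: every functional is small on a coordinate subspace. -/
lemma exists_small {C : ℝ} (hB : IsDualPair B) (hb : IsBiorthogonalBasis B e f)
    (hu : IsUnconditionalWith B e C) (hsp : IsNonL1Splicing B e f) (c : ℕ → X →L[ℝ] ℝ)
    (hc : ∀ j x, c j x = B x (f j)) (φ : X →L[ℝ] ℝ) (I : Set ℕ) (hI : I.Infinite) (η : ℝ)
    (hη : 0 < η) :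
    ∃ Λ ⊆ I, Λ.Infinite ∧ ∀ x, |φ (coordProj B e f Λ x)| ≤ η * ‖x‖ := by
  have hC : 0 < C := zero_lt_one.trans_le (one_le_of_unconditional hB hb hu)
  have hcext : ∀ x y, (∀ j, c j x = c j y) → x = y := fun x y h =>
    ext_of_coords hB hb fun j => by rw [← hc, ← hc, h]
  -- With this `θ`, `‖φ‖ * C * θ < η`, which the failure of the claim on every `Λ j` will
  -- contradict.
  obtain ⟨Λ, h1, h2, h3, h4⟩ := hsp I hI (η / (2 * C * (‖φ‖ + 1))) (by positivity)
  by_contra! hcon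
  choose x hx using fun j => hcon (Λ j) (h2 j) (h1 j)
  have hx0 : ∀ j, ‖x j‖ ≠ 0 := fun j h0 => by
    have := norm_coordProj_le hB hb hu (Λ j) (x j)
    rw [h0, mul_zero] at this
    have h := hx j
    rw [norm_le_zero_iff.1 this, h0, map_zero, abs_zero, mul_zero] at h
    exact lt_irrefl _ h
  set y : ℕ → X := fun j => ‖x j‖⁻¹ • x j with hy
  set Py : ℕ → X := fun j => coordProj B e f (Λ j) (y j) with hPy
  have hPyx : ∀ j, Py j = ‖x j‖⁻¹ • coordProj B e f (Λ j) (x j) := fun j => by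
    refine ext_of_coords hB hb fun k => ?_
    rw [hPy, map_smul, LinearMap.smul_apply, apply_coordProj hb hu, apply_coordProj hb hu, hy]
    by_cases hk : k ∈ Λ j <;> simp [hk]
  have hlow : ∀ j, η ≤ |φ (Py j)| := fun j => by
    have hpos : 0 < ‖x j‖ := lt_of_le_of_ne (norm_nonneg _) (hx0 j).symm
    rw [hPyx, map_smul, smul_eq_mul, abs_mul, abs_inv, abs_norm, inv_mul_eq_div, le_div_iff₀ hpos]
    exact (hx j).le
  obtain ⟨a, z, ha, hz, hzn⟩ := h4 y fun j => by
    rw [hy, norm_smul, norm_inv, norm_norm, inv_mul_cancel₀ (hx0 j)]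
  set σ : ℕ → ℝ := fun j => SignType.sign (a j) * SignType.sign (φ (Py j)) with hσ
  have hsign : ∀ t : ℝ, |(SignType.sign t : ℝ)| ≤ 1 := fun t => by
    rcases lt_trichotomy t 0 with h | h | h <;> simp [h]
  have hσ1 : ∀ j, |σ j| ≤ 1 := fun j => by
    rw [hσ, abs_mul]
    exact mul_le_one₀ (hsign _) (abs_nonneg _) (hsign _)
  classical
  -- The multiplier equals `σ j` on `Λ j`, so it makes every term of the series contribute `|a j| *
  -- |φ (Py j)|` under `φ`.
  set γ : ℕ → ℝ := fun k => if h : ∃ j, k ∈ Λ j then σ h.choose else 0 with hγ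
  have hγσ : ∀ j, ∀ k ∈ Λ j, γ k = σ j := fun j k hk => by
    have h : ∃ j, k ∈ Λ j := ⟨j, hk⟩
    rw [hγ]
    beta_reduce
    rw [dif_pos h]
    congr 1
    by_contra hne
    exact (Set.disjoint_left.1 (h3 _ _ hne)) h.choose_spec hk
  have hγ1 : ∀ k, |γ k| ≤ 1 := fun k => by
    rw [hγ]
    beta_reduce
    split_ifs with h
    · exact hσ1 _
    · simp
  obtain ⟨A, hA, hAn⟩ := exists_clm_of_coords c hcext γ id (C * 1) fun x => by
    obtain ⟨z, hz, hn⟩ := exists_mul hb hu hC.le γ 1 hγ1 x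
    exact ⟨z, fun j => by rw [hc, hc, hz, id], hn⟩
  have hAP : ∀ j, A (Py j) = σ j • Py j := fun j => hcext _ _ fun k => by
    rw [hA, map_smul, smul_eq_mul, id, hc, hPy, apply_coordProj hb hu]
    by_cases hk : k ∈ Λ j
    · rw [hγσ j k hk]
    · simp [hk]
  have hsum := hz.mapL (φ ∘L A)
  have hterm : ∀ j, |a j| * η ≤ (φ ∘L A) (a j • Py j) := fun j => by
    have e : (φ ∘L A) (a j • Py j) = |a j| * |φ (Py j)| := by
      change φ (A (a j • Py j)) = _
      rw [map_smul, hAP, map_smul, map_smul, smul_eq_mul, smul_eq_mul, ← self_mul_sign (a j),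
        ← self_mul_sign (φ (Py j)), hσ]
      ring
    rw [e]
    exact mul_le_mul_of_nonneg_left (hlow j) (abs_nonneg _)
  have hge : 1 * η ≤ (φ ∘L A) z := hasSum_le hterm (ha.mul_right η) hsum
  have hle : (φ ∘L A) z ≤ ‖φ‖ * (C * 1 * (η / (2 * C * (‖φ‖ + 1)))) :=
    (le_abs_self _).trans ((φ.le_opNorm _).trans (mul_le_mul_of_nonneg_left
      ((hAn z).trans (mul_le_mul_of_nonneg_left hzn (by positivity))) (norm_nonneg _)))
  have hlt : ‖φ‖ * (C * 1 * (η / (2 * C * (‖φ‖ + 1)))) < η := by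
    have hφ := norm_nonneg φ
    have e : ‖φ‖ * (C * 1 * (η / (2 * C * (‖φ‖ + 1)))) = η * (‖φ‖ / (2 * (‖φ‖ + 1))) := by
      field_simp
    rw [e]
    refine mul_lt_of_lt_one_right hη ?_
    rw [div_lt_one (by positivity)]
    linarith
  linarith

/-- The constant `C ^ 2 + D` dominates all the bounds at once: `C ^ 2` is needed for compression and
`D`, from the pairing, for the coordinate functionals. -/
lemma nonempty_coordSystem (hB : IsDualPair B) (hb : IsBiorthogonalBasis B e f)
    (hsub : IsSubsymmetric B e) (hsp : IsNonL1Splicing B e f) : Nonempty (CoordSystem X) := by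
  obtain ⟨C, hu, hs⟩ := hsub
  obtain ⟨D, hD, hBD⟩ := hB.bounded
  have hC := one_le_of_unconditional hB hb hu
  have hC0 : 0 < C := zero_lt_one.trans_le hC
  have hCC : C ≤ C ^ 2 := by nlinarith
  set c : ℕ → X →L[ℝ] ℝ := fun j => LinearMap.mkContinuous (B.flip (f j)) D fun x => by
    simpa [hb.norm_right] using hBD x (f j) with hcdef
  have hc : ∀ j x, c j x = B x (f j) := fun _ _ => rfl
  have hbound : ∀ {a b M : ℝ} {x : X}, 0 ≤ M → a ≤ b * M * ‖x‖ → b ≤ C ^ 2 + D →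
      a ≤ (C ^ 2 + D) * M * ‖x‖ := fun hM h1 h2 => h1.trans (by gcongr)
  have hbound' : ∀ {a b : ℝ} {x : X}, a ≤ b * ‖x‖ → b ≤ C ^ 2 + D → a ≤ (C ^ 2 + D) * ‖x‖ :=
    fun h1 h2 => h1.trans (by gcongr)
  refine ⟨⟨e, c, C ^ 2 + D, by linarith, hb.norm_left, fun j x => ?_, fun j k => ?_,
    fun x y h => ext_of_coords hB hb fun j => by rw [← hc, ← hc, h], fun γ M hM x => ?_,
    fun n hn x => ?_, fun n hn x => ?_, fun φ I hI η hη => ?_⟩⟩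
  · refine hbound' (b := D) ?_ (by nlinarith)
    rw [hc]
    simpa [hb.norm_right] using hBD x (f j)
  · rw [hc]
    split_ifs with h
    · rw [h, hb.pair_self]
    · exact hb.pair_ne _ _ (Ne.symm h)
  · obtain ⟨z, h1, h2⟩ := exists_mul hb hu hC0.le γ M hM x
    exact ⟨z, h1, hbound ((abs_nonneg _).trans (hM 0)) h2 (by linarith)⟩
  · obtain ⟨z, h1, h2⟩ := exists_spread hB hb hs hC0 n hn x
    exact ⟨z, h1, hbound' h2 (by linarith)⟩
  · obtain ⟨z, h1, h2⟩ := exists_compress hB hb hu hs hC0.le n hn x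
    exact ⟨z, fun j => by rw [one_mul, hc, hc, h1], hbound' h2 (by linarith)⟩
  · obtain ⟨Λ, h1, h2, h3⟩ := exists_small hB hb hu hsp c hc φ I hI η hη
    refine ⟨Λ, h1, h2, fun x z hz => ?_⟩
    have : z = coordProj B e f Λ x := ext_of_coords hB hb fun j => by
      rw [apply_coordProj hb hu, ← hc, hz, hc]
      by_cases hj : j ∈ Λ <;> simp [hj]
    rw [this]
    exact h3 x

end DualPairing

end

end DualPair

theorem mainTheorem6 {X Y : Type*} [NormedAddCommGroup X] [NormedSpace ℝ X] [CompleteSpace X]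
    [NormedAddCommGroup Y] [NormedSpace ℝ Y] [CompleteSpace Y]
    (B : X →ₗ[ℝ] Y →ₗ[ℝ] ℝ) (e : ℕ → X) (f : ℕ → Y)
    (hB : DualPair.IsDualPair B) (hb : DualPair.IsBiorthogonalBasis B e f)
    (hsub : DualPair.IsSubsymmetric B e) (hsplice : DualPair.IsNonL1Splicing B e f)
    (p : ℝ≥0∞) [Fact (1 ≤ p)] :
    DualPair.IsPrimarySpace (lp (fun _ : ℕ => X) p) := by
  obtain ⟨S⟩ := DualPair.nonempty_coordSystem hB hb hsub hsplice
  exact S.isPrimarySpace
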